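/- Let $A$ be a self-adjoint operator in a separable complex Hilbert space $\mathcal H$ whose spectrum is $\sigma(A)=\{\mu_k\}_{k\in\mathbb N}$, $\mathbb N=\{1,2,\dots\}$, with $0<\mu_1<\mu_2<\dots$ and $\mu_k\to+\infty$. Put $$r_1=\tfrac12(\mu_2-\mu_1),\qquad r_k=\tfrac12\min\{\mu_k-\mu_{k-1},\,\mu_{k+1}-\mu_k\}\quad(k\ge2),$$ and let $$P_k^0=\frac1{2\pi\mathrm i}\int_{|z-\mu_k|=r_k}(z-A)^{-1}\,\mathrm dz$$ be the spectral projection of $A$ associated with $\mu_k$. Let $a(f,g)=\langle A^{1/2}f,A^{1/2}g\rangle$ for $f,g\in\operatorname{Dom}(A^{1/2})$, and let $v:\operatorname{Dom}(A^{1/2})\times\operatorname{Dom}(A^{1/2})\to\mathbb C$ be a sesquilinear form that is separately continuous with respect to the norm $\|A^{1/2}\cdot\|$ (that is, $v(f,\cdot)$ and $v(\cdot,g)$ are continuous in this norm for all fixed $f,g$). Suppose that for a real sequence $(\omega_j)_{j\in\mathbb N}$ $$|v(P_j^0f,P_k^0g)|\le\omega_j\omega_k\|P_j^0f\|\,\|P_k^0g\|,\qquad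 j,k\in\mathbb N,\ f,g\in\operatorname{Dom}(A^{1/2}),$$ $$\sum_{j=1}^\infty\frac{\omega_j^2}{\mu_j}<\infty,\qquad \sum_{j\ne n}\frac{\omega_j^2}{|\mu_n-\mu_j|}+\frac{\omega_n^2}{r_n}\to0\quad(n\to\infty).$$ Let $T$ be the operator associated with the form $t=a+v$, $\operatorname{Dom}(t)=\operatorname{Dom}(A^{1/2})$: $f\in\operatorname{Dom}(T)$ and $Tf=h$ if and only if $f\in\operatorname{Dom}(A^{1/2})$ and $t(f,g)=\langle h,g\rangle$ for all $g\in\operatorname{Dom}(A^{1/2})$. Then there exist $N_0\in\mathbb N$ and $h_1,h_2>0$ such that, with $$\Pi_0=\{z\in\mathbb C:\,-h_1<\operatorname{Re}z\le\mu_{N_0}+r_{N_0},\ |\operatorname{Im}z|\le h_2\},\qquad \Pi_k=\{z\in\mathbb C:\,|z-\mu_k|<r_k\},$$ one has $$\sigma(T)\subset\Pi_0\cup\bigcup_{k>N_0}\Pi_k .$$ Moreover, $\partial\Pi_0$ and $\partial\Pi_k$, $k>N_0$, lie in the resolvent set of $T$ and the resolvent of $T$ is norm continuous on them, so that the integrals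 over the positively oriented boundaries $$S_0=\frac1{2\pi\mathrm i}\int_{\partial\Pi_0}(z-T)^{-1}\,\mathrm dz,\qquad P_k=\frac1{2\pi\mathrm i}\int_{\partial\Pi_k}(z-T)^{-1}\,\mathrm dz,\quad k>N_0,$$ are well defined; $S_0$ and all $P_k$, $k>N_0$, are bounded projections, they are disjoint, i.e. $S_0P_k=P_kS_0=0$ and $P_jP_k=0$ for $j,k>N_0$, $j\ne k$; and $$\operatorname{rank}(S_0)=\operatorname{rank}\Big(\sum_{k=1}^{N_0}P_k^0\Big),\qquad \operatorname{rank}(P_k)=\operatorname{rank}(P_k^0),\quad k>N_0,$$ where the rank is the dimension of the range, which may be infinite. -/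

import Mathlib

open Filter Topology

noncomputable section

namespace LocalFormSub

variable {H : Type*} [NormedAddCommGroup H] [InnerProductSpace ℂ H] [CompleteSpace H]

/-! Resolvents and spectra of (unbounded) operators in a Hilbert space. -/

/-- `R` is a bounded everywhere defined inverse of `z - T : Dom T → H`. -/
def IsResolventAt (T : H →ₗ.[ℂ] H) (z : ℂ) (R : H →L[ℂ] H) : Prop :=
  (∀ x : H, ∃ y : T.domain, (y : H) = R x ∧ z • (y : H) - T y = x) ∧
    ∀ y : T.domain, R (z • (y : H) - T y) = (y : H)

/-- The resolvent set `ρ(T)`. -/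
def resolventSet (T : H →ₗ.[ℂ] H) : Set ℂ := {z | ∃ R : H →L[ℂ] H, IsResolventAt T z R}

/-- The spectrum `σ(T)`. -/
def spectrum (T : H →ₗ.[ℂ] H) : Set ℂ := (resolventSet T)ᶜ

open Classical in
/-- The resolvent `(z - T)⁻¹` for `z ∈ ρ(T)` (and `0` elsewhere). -/
def resolvent (T : H →ₗ.[ℂ] H) (z : ℂ) : H →L[ℂ] H :=
  if h : ∃ R : H →L[ℂ] H, IsResolventAt T z R then h.choose else 0

/-- `(2πi)⁻¹ ∫ (z - T)⁻¹ dz` over the positively oriented circle `|z - c| = R`. -/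
def circleProj (T : H →ₗ.[ℂ] H) (c : ℂ) (R : ℝ) : H →L[ℂ] H :=
  (2 * (Real.pi : ℂ) * Complex.I)⁻¹ • ∮ z in C(c, R), resolvent T z

/-- `(2πi)⁻¹ ∫ (z - T)⁻¹ dz` over the positively oriented boundary of the rectangle
`a ≤ Re z ≤ b`, `c ≤ Im z ≤ d`. -/
def rectProj (T : H →ₗ.[ℂ] H) (a b c d : ℝ) : H →L[ℂ] H :=
  (2 * (Real.pi : ℂ) * Complex.I)⁻¹ •
    ((∫ x in a..b, resolvent T (x + c * Complex.I))
      + Complex.I • (∫ y in c..d, resolvent T (b + y * Complex.I))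
      - (∫ x in a..b, resolvent T (x + d * Complex.I))
      - Complex.I • (∫ y in c..d, resolvent T (a + y * Complex.I)))

/-! The eigenvalue sequence. Sequences are indexed from `0`, so `μ k` is the `(k+1)`-st
eigenvalue. -/

/-- Half of the distance from `μ k` to its neighbours in the sequence. -/
def radius (μ : ℕ → ℝ) : ℕ → ℝ
  | 0 => (μ 1 - μ 0) / 2
  | k + 1 => min (μ (k + 1) - μ k) (μ (k + 2) - μ (k + 1)) / 2

/-- `σ(A) = {μ₀ < μ₁ < ...}` with `0 < μ₀` and `μ k → ∞`. -/
def HasSpectrumSeq (A : H →ₗ.[ℂ] H) (μ : ℕ → ℝ) : Prop :=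
  spectrum A = Set.range (fun k => (μ k : ℂ)) ∧ 0 < μ 0 ∧ StrictMono μ ∧ Tendsto μ atTop atTop

/-- The spectral projection of `A` on the eigenvalue `μ k`, as a Riesz projection. -/
def specProj (A : H →ₗ.[ℂ] H) (μ : ℕ → ℝ) (k : ℕ) : H →L[ℂ] H :=
  circleProj A (μ k : ℂ) (radius μ k)

/-- The square root of a self-adjoint `A` with spectrum `{μ k}`, by its spectral resolution:
`A^{1/2} f = ∑ₖ μₖ^{1/2} Pₖ f` on all `f` for which this series converges in `H`. The terms are
pairwise orthogonal, so convergence means `∑ₖ μₖ ‖Pₖ f‖² < ∞`. -/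
def sqrtOp (A : H →ₗ.[ℂ] H) (μ : ℕ → ℝ) : H →ₗ.[ℂ] H where
  domain :=
    { carrier := {f | Summable fun k => ((Real.sqrt (μ k) : ℝ) : ℂ) • specProj A μ k f}
      add_mem' := by
        intro f g hf hg
        simpa only [Set.mem_ofPred_eq, map_add, smul_add] using Summable.add hf hg
      zero_mem' := by
        simpa only [Set.mem_ofPred_eq, map_zero, smul_zero] using summable_zero
      smul_mem' := by
        intro c f hf
        have h := Summable.const_smul c hf
        simpa only [Set.mem_ofPred_eq, map_smul, smul_comm c] using h }
  toFun :=
    { toFun := fun f => ∑' k, ((Real.sqrt (μ k) : ℝ) : ℂ) • specProj A μ k (f : H)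
      map_add' := by
        intro f g
        rw [← Summable.tsum_add f.2 g.2]
        simp only [Submodule.coe_add, map_add, smul_add]
      map_smul' := by
        intro c f
        rw [RingHom.id_apply, ← Summable.tsum_const_smul c f.2]
        simp only [Submodule.coe_smul, map_smul, smul_comm c] }

/-- The form domain `Dom(a) = Dom(A^{1/2})`. -/
abbrev formDomain (A : H →ₗ.[ℂ] H) (μ : ℕ → ℝ) : Submodule ℂ H := (sqrtOp A μ).domain

/-- Sesquilinear forms on a subspace `D`: linear in the first argument and conjugate linear in the
second one. -/
abbrev SesqForm (D : Submodule ℂ H) := D →ₗ[ℂ] D →ₗ⋆[ℂ] ℂ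

/-- The form `a(f, g) = ⟨A^{1/2} f, A^{1/2} g⟩` of `A`. Mathlib's `inner ℂ x y` is linear in `y`,
so `⟨x, y⟩` of the usual convention here is `inner ℂ y x`. -/
def baseForm (A : H →ₗ.[ℂ] H) (μ : ℕ → ℝ) : SesqForm (formDomain A μ) :=
  LinearMap.mk₂'ₛₗ (RingHom.id ℂ) (starRingEnd ℂ)
    (fun f g => inner ℂ (sqrtOp A μ g) (sqrtOp A μ f))
    (by intro f f' g; rw [LinearPMap.map_add, inner_add_right])
    (by intro c f g; rw [LinearPMap.map_smul, inner_smul_right]; rfl)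
    (by intro f g g'; rw [LinearPMap.map_add, inner_add_left])
    (by intro c f g; rw [LinearPMap.map_smul, inner_smul_left]; rfl)

/-- The graph of the operator associated with a form `t` with domain `D`: all `(f, h)` with
`f ∈ D` and `t(f, g) = ⟨h, g⟩` for all `g ∈ D`. -/
def formGraph (D : Submodule ℂ H) (t : SesqForm D) : Submodule ℂ (H × H) where
  carrier := {p | ∃ f : D, (f : H) = p.1 ∧ ∀ g : D, t f g = inner ℂ (g : H) p.2}
  add_mem' := by
    rintro p q ⟨f, hf, hf'⟩ ⟨g, hg, hg'⟩
    refine ⟨f + g, ?_, fun x => ?_⟩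
    · rw [Submodule.coe_add, hf, hg, Prod.fst_add]
    · rw [map_add, LinearMap.add_apply, hf', hg', Prod.snd_add, inner_add_right]
  zero_mem' := ⟨0, rfl, fun x => by simp⟩
  smul_mem' := by
    rintro c p ⟨f, hf, hf'⟩
    refine ⟨c • f, ?_, fun x => ?_⟩
    · rw [Submodule.coe_smul, hf, Prod.smul_fst]
    · rw [map_smul, LinearMap.smul_apply, hf', Prod.smul_snd, inner_smul_right, smul_eq_mul]

/-- The operator associated with a form `t` with (dense) domain `D`, as in the first
representation theorem: `f ∈ Dom T` and `T f = h` iff `f ∈ D` and `t(f, g) = ⟨h, g⟩` for all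
`g ∈ D`. -/
def formOperator (D : Submodule ℂ H) (t : SesqForm D) : H →ₗ.[ℂ] H :=
  (formGraph D t).toLinearPMap

/-- The form sum of `A` and `v`: the operator associated with `t = a + v`. -/
def formSum (A : H →ₗ.[ℂ] H) (μ : ℕ → ℝ) (v : SesqForm (formDomain A μ)) : H →ₗ.[ℂ] H :=
  formOperator (formDomain A μ) (baseForm A μ + v)

/-- `v` is separately continuous on `Dom(A^{1/2})` with respect to the norm `‖A^{1/2} f‖`. -/
def SeparatelyContinuous (A : H →ₗ.[ℂ] H) (μ : ℕ → ℝ) (v : SesqForm (formDomain A μ)) : Prop :=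
  (∀ f : formDomain A μ, ∃ C : ℝ, ∀ g : formDomain A μ, ‖v f g‖ ≤ C * ‖sqrtOp A μ g‖) ∧
    ∀ g : formDomain A μ, ∃ C : ℝ, ∀ f : formDomain A μ, ‖v f g‖ ≤ C * ‖sqrtOp A μ f‖

/-- Local subordination `|v(P_j f, P_k g)| ≤ ω_j ω_k ‖P_j f‖ ‖P_k g‖` for `f, g ∈ Dom(A^{1/2})`.
Here `x` and `y` are `P_j f` and `P_k g`, as elements of `Dom(A^{1/2})`. -/
def LocallySubordinated (A : H →ₗ.[ℂ] H) (μ ω : ℕ → ℝ) (v : SesqForm (formDomain A μ)) : Prop :=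
  ∀ (j k : ℕ) (f g x y : formDomain A μ),
    (x : H) = specProj A μ j (f : H) → (y : H) = specProj A μ k (g : H) →
      ‖v x y‖ ≤ ω j * ω k * ‖specProj A μ j (f : H)‖ * ‖specProj A μ k (g : H)‖

/-- The conditions `∑ ω_j² / μ_j < ∞` and
`∑_{j ≠ n} ω_j² / |μ_n - μ_j| + ω_n² / r_n → 0` as `n → ∞`. -/
def WeightCondition (μ ω : ℕ → ℝ) : Prop :=
  (Summable fun j => ω j ^ 2 / μ j) ∧
    (∀ n, Summable fun j => if j = n then 0 else ω j ^ 2 / |μ n - μ j|) ∧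
    Tendsto (fun n => (∑' j, if j = n then 0 else ω j ^ 2 / |μ n - μ j|)
      + ω n ^ 2 / radius μ n) atTop (𝓝 0)

/-- The box `Π₀(N, h₁, h₂)`. -/
def box (μ : ℕ → ℝ) (N : ℕ) (h₁ h₂ : ℝ) : Set ℂ :=
  {z | -h₁ < z.re ∧ z.re ≤ μ N + radius μ N ∧ |z.im| ≤ h₂}

/-- The open disk `Π_k = B_{r_k}(μ_k)`. -/
def disk (μ : ℕ → ℝ) (k : ℕ) : Set ℂ := Metric.ball (μ k : ℂ) (radius μ k)

/-- `S₀ = (2πi)⁻¹ ∫_{∂Π₀} (z - T)⁻¹ dz`. -/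
def boxProj (T : H →ₗ.[ℂ] H) (μ : ℕ → ℝ) (N : ℕ) (h₁ h₂ : ℝ) : H →L[ℂ] H :=
  rectProj T (-h₁) (μ N + radius μ N) (-h₂) h₂

/-- `P_k = (2πi)⁻¹ ∫_{∂Π_k} (z - T)⁻¹ dz`. -/
def diskProj (T : H →ₗ.[ℂ] H) (μ : ℕ → ℝ) (k : ℕ) : H →L[ℂ] H :=
  circleProj T (μ k : ℂ) (radius μ k)

/-- The (possibly infinite) rank of a bounded operator: the dimension of its range. -/
def opRank (S : H →L[ℂ] H) : Cardinal := LinearMap.rank (S : H →ₗ[ℂ] H)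

end LocalFormSub

end

/-! Write `B` for the bounded inverse of `A`. Since `B^{1/2}` maps `H` onto the form domain, `v` is
carried over to a bounded operator `K` with `v(f, g) = ⟨K A^{1/2} f, A^{1/2} g⟩`, and then `(z -
T)⁻¹ = B^{1/2} (z B - 1 - K)⁻¹ B^{1/2}` wherever the bounded pencil `z B - 1 - K` is invertible
(`exists_operator_of_form`, `isResolventAt_formSum`). All unboundedness of `T` is thereby removed.

The pencil is invertible as soon as `∑ ω_j² / |z - μ_j| < 1`. With the polar decomposition `z B - 1
= |z B - 1|^{1/2} U |z B - 1|^{1/2}` it factors through `1 - U⁻¹ X`, where `X` is `K` compressed by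
`|z B - 1|^{-1/2}` on both sides. Local subordination and Cauchy-Schwarz bound `‖X‖` by that sum.
The same bound holds for `s K`, `0 ≤ s ≤ 1` (`isUnit_pencil`). The weight conditions make the sum
small off a large box and off the disks of large index, and also in a shell just inside each of
their boundaries (`exists_admissible`).

The Riesz integrals are then treated by contours alone. The boundary of each region can be pushed
inwards through its shell without changing the integral. The resolvent identity on two disjoint
contours gives the product of two Riesz integrals in terms of winding numbers, hence idempotency and
disjointness (`integral_mul_integral`). Along `s K` the projections move continuously in norm, and
projections at distance less than `1` have equal rank, finite or not. At `s = 0` they are sums of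
spectral projections of `A` (`opRank_eq_of_continuousOn`, `integral_pencilResolvent_zero`). -/

noncomputable section

namespace LocalFormSub

open MeasureTheory Set

/-! ### Contour integrals and their products. -/

/-- A finite family of weighted parametrized arcs in the complex plane. -/
structure Contour where
  n : ℕ
  lower : Fin n → ℝ
  upper : Fin n → ℝ
  le : ∀ i, lower i ≤ upper i
  path : Fin n → ℝ → ℂ
  velocity : Fin n → ℝ → ℂ
  continuous_path : ∀ i, Continuous (path i)
  continuous_velocity : ∀ i, Continuous (velocity i)

namespace Contour

variable {E : Type*} [NormedAddCommGroup E] [NormedSpace ℂ E]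
variable {F : Type*} [NormedAddCommGroup F] [NormedSpace ℂ F]

/-- The integral of `f` along a contour. -/
def integral (c : Contour) (f : ℂ → E) : E :=
  ∑ i, ∫ t in c.lower i..c.upper i, c.velocity i t • f (c.path i t)

/-- The set of points of a contour. -/
def trace (c : Contour) : Set ℂ := ⋃ i, c.path i '' Icc (c.lower i) (c.upper i)

theorem path_mem_trace (c : Contour) {i : Fin c.n} {t : ℝ} (ht : t ∈ uIcc (c.lower i) (c.upper i)) :
    c.path i t ∈ c.trace := by
  rw [uIcc_of_le (c.le i)] at ht
  exact mem_iUnion.2 ⟨i, t, ht, rfl⟩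

theorem isCompact_trace (c : Contour) : IsCompact c.trace :=
  isCompact_iUnion fun i => isCompact_Icc.image (c.continuous_path i)

theorem continuousOn_comp_path (c : Contour) {f : ℂ → E} (hf : ContinuousOn f c.trace)
    (i : Fin c.n) :
    ContinuousOn (fun t => c.velocity i t • f (c.path i t)) (uIcc (c.lower i) (c.upper i)) :=
  (c.continuous_velocity i).continuousOn.smul
    (hf.comp (c.continuous_path i).continuousOn fun _ ht => c.path_mem_trace ht)

theorem intervalIntegrable (c : Contour) {f : ℂ → E} (hf : ContinuousOn f c.trace)
    (i : Fin c.n) :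
    IntervalIntegrable (fun t => c.velocity i t • f (c.path i t)) volume
      (c.lower i) (c.upper i) :=
  (c.continuousOn_comp_path hf i).intervalIntegrable

theorem integral_congr (c : Contour) {f g : ℂ → E} (h : EqOn f g c.trace) :
    c.integral f = c.integral g :=
  Finset.sum_congr rfl fun _ _ => intervalIntegral.integral_congr fun _ ht => by
    simp only [h (c.path_mem_trace ht)]

theorem integral_add (c : Contour) {f g : ℂ → E} (hf : ContinuousOn f c.trace)
    (hg : ContinuousOn g c.trace) :
    c.integral (fun z => f z + g z) = c.integral f + c.integral g := by
  simp only [integral, smul_add]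
  rw [← Finset.sum_add_distrib]
  exact Finset.sum_congr rfl fun i _ =>
    intervalIntegral.integral_add (c.intervalIntegrable hf i) (c.intervalIntegrable hg i)

theorem integral_sub (c : Contour) {f g : ℂ → E} (hf : ContinuousOn f c.trace)
    (hg : ContinuousOn g c.trace) :
    c.integral (fun z => f z - g z) = c.integral f - c.integral g := by
  simp only [integral, smul_sub]
  rw [← Finset.sum_sub_distrib]
  exact Finset.sum_congr rfl fun i _ =>
    intervalIntegral.integral_sub (c.intervalIntegrable hf i) (c.intervalIntegrable hg i)

theorem integral_const_smul (c : Contour) (a : ℂ) (f : ℂ → E) :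
    c.integral (fun z => a • f z) = a • c.integral f := by
  simp only [integral, Finset.smul_sum]
  refine Finset.sum_congr rfl fun i _ => ?_
  rw [← intervalIntegral.integral_smul]
  simp only [smul_comm a]

theorem integral_map [CompleteSpace E] [CompleteSpace F] (c : Contour) (T : E →L[ℂ] F) {f : ℂ → E}
    (hf : ContinuousOn f c.trace) :
    c.integral (fun z => T (f z)) = T (c.integral f) := by
  simp only [integral, map_sum]
  refine Finset.sum_congr rfl fun i _ => ?_
  rw [← ContinuousLinearMap.intervalIntegral_comp_comm _ (c.intervalIntegrable hf i)]
  simp only [map_smul]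

theorem integral_smul_const [CompleteSpace E] (c : Contour) {f : ℂ → ℂ}
    (hf : ContinuousOn f c.trace) (x : E) :
    c.integral (fun z => f z • x) = c.integral f • x := by
  simpa using c.integral_map (ContinuousLinearMap.toSpanSingleton ℂ x) hf

theorem exists_norm_integral_le (c : Contour) :
    ∃ C : ℝ, 0 ≤ C ∧ ∀ (f : ℂ → E) (M : ℝ), (∀ z ∈ c.trace, ‖f z‖ ≤ M) →
      ‖c.integral f‖ ≤ C * M := by
  have hv : ∀ i, ∃ C, ∀ t ∈ Icc (c.lower i) (c.upper i), ‖c.velocity i t‖ ≤ C := fun i =>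
    isCompact_Icc.exists_bound_of_continuousOn (c.continuous_velocity i).continuousOn
  choose C hC using hv
  have hC0 : ∀ i, 0 ≤ C i := fun i =>
    (norm_nonneg _).trans (hC i _ (left_mem_Icc.2 (c.le i)))
  refine ⟨∑ i, C i * |c.upper i - c.lower i|,
    Finset.sum_nonneg fun i _ => mul_nonneg (hC0 i) (abs_nonneg _), fun f M hM => ?_⟩
  rw [Finset.sum_mul]
  refine norm_sum_le_of_le _ fun i _ => ?_
  have h := intervalIntegral.norm_integral_le_of_norm_le_const
    (f := fun t => c.velocity i t • f (c.path i t)) (a := c.lower i) (b := c.upper i)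
    (C := C i * M) fun t ht => by
      have ht' := uIoc_subset_uIcc ht
      rw [norm_smul]
      exact mul_le_mul (hC i t (by rwa [uIcc_of_le (c.le i)] at ht'))
        (hM _ (c.path_mem_trace ht')) (norm_nonneg _) (hC0 i)
  calc _ ≤ _ := h
    _ = _ := by ring

theorem integrableOn_prod (c d : Contour) {f : ℂ → ℂ → E}
    (hf : ContinuousOn (Function.uncurry f) (c.trace ×ˢ d.trace)) (i : Fin c.n) (j : Fin d.n) :
    IntegrableOn
      (Function.uncurry fun t s : ℝ =>
        c.velocity i t • d.velocity j s • f (c.path i t) (d.path j s))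
      (uIoc (c.lower i) (c.upper i) ×ˢ uIoc (d.lower j) (d.upper j)) := by
  have hcont : ContinuousOn
      (Function.uncurry fun t s : ℝ =>
        c.velocity i t • d.velocity j s • f (c.path i t) (d.path j s))
      (uIcc (c.lower i) (c.upper i) ×ˢ uIcc (d.lower j) (d.upper j)) := by
    refine ((c.continuous_velocity i).comp continuous_fst).continuousOn.smul
      (((d.continuous_velocity j).comp continuous_snd).continuousOn.smul ?_)
    exact hf.comp (f := fun p : ℝ × ℝ => (c.path i p.1, d.path j p.2))
      (((c.continuous_path i).comp continuous_fst).prodMk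
        ((d.continuous_path j).comp continuous_snd)).continuousOn
      fun p hp => ⟨c.path_mem_trace hp.1, d.path_mem_trace hp.2⟩
  exact (hcont.integrableOn_compact (isCompact_uIcc.prod isCompact_uIcc)).mono_set
    (prod_mono uIoc_subset_uIcc uIoc_subset_uIcc)

theorem integral_integral_eq_sum (c d : Contour) {f : ℂ → ℂ → E}
    (hf : ContinuousOn (Function.uncurry f) (c.trace ×ˢ d.trace)) :
    c.integral (fun z => d.integral fun w => f z w) = ∑ i, ∑ j,
      ∫ t in c.lower i..c.upper i, ∫ s in d.lower j..d.upper j,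
        c.velocity i t • d.velocity j s • f (c.path i t) (d.path j s) := by
  simp only [integral]
  refine Finset.sum_congr rfl fun i _ => ?_
  rw [← intervalIntegral.integral_finsetSum]
  · refine intervalIntegral.integral_congr fun t _ => ?_
    simp only [Finset.smul_sum, intervalIntegral.integral_smul]
  · intro j _
    have h := c.integrableOn_prod d hf i j
    rw [IntegrableOn, Measure.volume_eq_prod, ← Measure.prod_restrict] at h
    have h' := h.integral_prod_left
    rw [intervalIntegrable_iff]
    simpa only [IntegrableOn, intervalIntegral.integral_of_le (d.le j), uIoc_of_le (d.le j),
      Function.uncurry_apply_pair] using h'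

theorem integral_integral_swap (c d : Contour) {f : ℂ → ℂ → E}
    (hf : ContinuousOn (Function.uncurry f) (c.trace ×ˢ d.trace)) :
    c.integral (fun z => d.integral fun w => f z w)
      = d.integral fun w => c.integral fun z => f z w := by
  have hf' : ContinuousOn (Function.uncurry fun w z => f z w) (d.trace ×ˢ c.trace) :=
    hf.comp continuous_swap.continuousOn fun p hp => ⟨hp.2, hp.1⟩
  rw [c.integral_integral_eq_sum d hf, d.integral_integral_eq_sum c hf', Finset.sum_comm]
  refine Finset.sum_congr rfl fun j _ => Finset.sum_congr rfl fun i _ => ?_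
  rw [intervalIntegral_intervalIntegral_swap (c.integrableOn_prod d hf i j)]
  simp only [smul_comm (c.velocity i _)]

/-- The integral of `(ζ - w)⁻¹` along the contour, `2πi` times the winding number. -/
def index (c : Contour) (w : ℂ) : ℂ := c.integral fun z => (z - w)⁻¹

/-- Dividing the resolvent identity by `w - z`, which cannot vanish on disjoint traces, splits the
double integral of `R z * R w` into two. In each, one variable (after Fubini in the second) occurs
only in the Cauchy kernel and integrates to a winding number. Nested contours and contours outside
each other are both covered by the choice of `m` and `n`, which include the factor `2πi`. -/
theorem integral_mul_integral {𝔸 : Type*} [NormedRing 𝔸] [NormedAlgebra ℂ 𝔸] [CompleteSpace 𝔸]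
    (c d : Contour) (hcd : Disjoint c.trace d.trace) {R : ℂ → 𝔸}
    (hc : ContinuousOn R c.trace) (hd : ContinuousOn R d.trace)
    (hR : ∀ z ∈ c.trace, ∀ w ∈ d.trace, R z - R w = (w - z) • (R z * R w))
    {m n : ℂ} (hm : ∀ w ∈ d.trace, c.index w = m) (hn : ∀ z ∈ c.trace, d.index z = n) :
    c.integral R * d.integral R = n • c.integral R + m • d.integral R := by
  have hne : ∀ z ∈ c.trace, ∀ w ∈ d.trace, w - z ≠ 0 := fun z hz w hw h =>
    hcd.ne_of_mem hz hw (sub_eq_zero.1 h).symm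
  have hker : ContinuousOn (fun p : ℂ × ℂ => (p.2 - p.1)⁻¹) (c.trace ×ˢ d.trace) :=
    (continuous_snd.sub continuous_fst).continuousOn.inv₀ fun p hp => hne _ hp.1 _ hp.2
  have hF : ContinuousOn (Function.uncurry fun z w : ℂ => (w - z)⁻¹ • R w)
      (c.trace ×ˢ d.trace) :=
    hker.smul (hd.comp continuous_snd.continuousOn fun p hp => hp.2)
  have hkz : ∀ z ∈ c.trace, ContinuousOn (fun w => (w - z)⁻¹) d.trace := fun z hz =>
    hker.comp (f := fun w => (z, w)) (by fun_prop) fun w hw => ⟨hz, hw⟩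
  have hkw : ∀ w ∈ d.trace, ContinuousOn (fun z => (z - w)⁻¹) c.trace := fun w hw =>
    (continuous_id.sub continuous_const).continuousOn.inv₀ fun z hz h =>
      hne z hz w hw (by rw [← neg_sub, neg_eq_zero]; exact h)
  have hinner : EqOn (fun z => R z * d.integral R)
      (fun z => n • R z - d.integral fun w => (w - z)⁻¹ • R w) c.trace := by
    intro z hz
    calc R z * d.integral R = d.integral fun w => R z * R w :=
          (d.integral_map (ContinuousLinearMap.mul ℂ 𝔸 (R z)) hd).symm
      _ = d.integral fun w => (w - z)⁻¹ • R z - (w - z)⁻¹ • R w := by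
          refine d.integral_congr fun w hw => ?_
          rw [← smul_sub, hR z hz w hw, smul_smul, inv_mul_cancel₀ (hne z hz w hw), one_smul]
      _ = _ := by
          refine (d.integral_sub (f := fun w => (w - z)⁻¹ • R z) (g := fun w => (w - z)⁻¹ • R w)
            ((hkz z hz).smul continuousOn_const) ((hkz z hz).smul hd)).trans ?_
          rw [d.integral_smul_const (hkz z hz)]
          simp only [← hn z hz, index]
  -- Continuity of this parameter integral is read off from `hinner`, which expresses it through `R
  -- z`.
  have hcont2 : ContinuousOn (fun z => d.integral fun w => (w - z)⁻¹ • R w) c.trace := by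
    have : EqOn (fun z => d.integral fun w => (w - z)⁻¹ • R w)
        (fun z => n • R z - R z * d.integral R) c.trace := fun z hz => by
      have := hinner hz
      simp only at this
      simp only [this, sub_sub_cancel]
    exact ((hc.const_smul n).sub (hc.mul continuousOn_const)).congr this
  calc c.integral R * d.integral R = c.integral fun z => R z * d.integral R :=
        (c.integral_map ((ContinuousLinearMap.mul ℂ 𝔸).flip (d.integral R)) hc).symm
    _ = c.integral fun z => n • R z - d.integral fun w => (w - z)⁻¹ • R w :=
        c.integral_congr hinner
    _ = n • c.integral R - d.integral fun w => c.integral fun z => (w - z)⁻¹ • R w := by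
        refine (c.integral_sub (f := fun z => n • R z) (hc.const_smul n) hcont2).trans ?_
        rw [c.integral_const_smul, c.integral_integral_swap d hF]
    _ = n • c.integral R - d.integral fun w => (-m) • R w := by
        congr 1
        refine d.integral_congr fun w hw => ?_
        rw [← hm w hw, index, ← neg_one_smul ℂ, ← c.integral_const_smul,
          ← c.integral_smul_const (f := fun z => (-1 : ℂ) • (z - w)⁻¹)
            ((hkw w hw).const_smul (-1 : ℂ))]
        congr 1
        funext z
        rw [neg_one_smul, ← inv_neg, neg_sub]
    _ = _ := by rw [d.integral_const_smul, neg_smul, sub_neg_eq_add]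

/-- The positively oriented circle. -/
def circle (w : ℂ) (r : ℝ) : Contour where
  n := 1
  lower _ := 0
  upper _ := 2 * Real.pi
  le _ := Real.two_pi_pos.le
  path _ := circleMap w r
  velocity _ := deriv (circleMap w r)
  continuous_path _ := continuous_circleMap w r
  continuous_velocity _ := by
    simp only [funext (deriv_circleMap w r)]
    exact (continuous_circleMap 0 r).mul continuous_const

theorem circle_integral (w : ℂ) (r : ℝ) (f : ℂ → E) :
    (circle w r).integral f = ∮ z in C(w, r), f z := by
  exact Fin.sum_univ_one _

theorem circle_trace (w : ℂ) {r : ℝ} (hr : 0 ≤ r) :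
    (circle w r).trace ⊆ Metric.sphere w r := by
  refine iUnion_subset fun i => ?_
  rintro _ ⟨t, -, rfl⟩
  exact circleMap_mem_sphere w hr t

/-- The positively oriented boundary of the rectangle `[a, b] × [c, d]`. -/
def rect (a b c d : ℝ) (hab : a ≤ b) (hcd : c ≤ d) : Contour where
  n := 4
  lower := ![a, c, a, c]
  upper := ![b, d, b, d]
  le := by
    rw [Fin.forall_fin_succ, Fin.forall_fin_succ, Fin.forall_fin_succ, Fin.forall_fin_one]
    exact ⟨hab, hcd, hab, hcd⟩
  path := ![fun x => x + c * Complex.I, fun y => b + y * Complex.I,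
    fun x => x + d * Complex.I, fun y => a + y * Complex.I]
  velocity := ![fun _ => 1, fun _ => Complex.I, fun _ => -1, fun _ => -Complex.I]
  continuous_path := by
    rw [Fin.forall_fin_succ, Fin.forall_fin_succ, Fin.forall_fin_succ, Fin.forall_fin_one]
    refine ⟨?_, ?_, ?_, ?_⟩ <;> simp <;> fun_prop
  continuous_velocity := by
    rw [Fin.forall_fin_succ, Fin.forall_fin_succ, Fin.forall_fin_succ, Fin.forall_fin_one]
    refine ⟨?_, ?_, ?_, ?_⟩ <;> exact continuous_const

theorem rect_integral (a b c d : ℝ) (hab : a ≤ b) (hcd : c ≤ d) (f : ℂ → E) :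
    (rect a b c d hab hcd).integral f =
      (∫ x in a..b, f (x + c * Complex.I))
      + Complex.I • (∫ y in c..d, f (b + y * Complex.I))
      - (∫ x in a..b, f (x + d * Complex.I))
      - Complex.I • (∫ y in c..d, f (a + y * Complex.I)) := by
  refine (Fin.sum_univ_four _).trans ?_
  simp [rect, sub_eq_add_neg, intervalIntegral.integral_smul]

theorem rect_trace (a b c d : ℝ) (hab : a ≤ b) (hcd : c ≤ d) :
    (rect a b c d hab hcd).trace ⊆ {z | z.re ∈ Icc a b ∧ z.im ∈ Icc c d ∧
      (z.re = a ∨ z.re = b ∨ z.im = c ∨ z.im = d)} := by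
  refine iUnion_subset ?_
  simp only [rect]
  rw [Fin.forall_fin_succ, Fin.forall_fin_succ, Fin.forall_fin_succ, Fin.forall_fin_one]
  refine ⟨?_, ?_, ?_, ?_⟩ <;> rintro _ ⟨t, ht, rfl⟩ <;> simp at ht ⊢ <;> grind

end Contour
end LocalFormSub

/-! ### Cauchy's theorem and winding numbers for circles and rectangles. -/

namespace LocalFormSub

open MeasureTheory Set

namespace Contour

variable {E : Type*} [NormedAddCommGroup E] [NormedSpace ℂ E]

theorem circle_index_of_mem_ball {c w : ℂ} {r : ℝ} (hw : w ∈ Metric.ball c r) :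
    (circle c r).index w = 2 * Real.pi * Complex.I := by
  rw [index, circle_integral, circleIntegral.integral_sub_inv_of_mem_ball hw]

theorem circle_index_of_notMem_closedBall {c w : ℂ} {r : ℝ} (hr : 0 ≤ r)
    (hw : w ∉ Metric.closedBall c r) : (circle c r).index w = 0 := by
  rw [index, circle_integral]
  have hne : ∀ z ∈ Metric.closedBall c r, z - w ≠ 0 := fun z hz h =>
    hw (by rwa [← sub_eq_zero.1 h])
  refine Complex.circleIntegral_eq_zero_of_differentiable_on_off_countable hr countable_empty
    ((continuous_id.sub continuous_const).continuousOn.inv₀ hne) fun z hz => ?_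
  exact (differentiableAt_id.sub_const w).inv (hne z (Metric.ball_subset_closedBall hz.1))

theorem circle_integral_eq_of_annulus [CompleteSpace E] {c : ℂ} {r R : ℝ} (h0 : 0 < r)
    (hle : r ≤ R) {f : ℂ → E}
    (hf : ∀ z ∈ Metric.closedBall c R \ Metric.ball c r, DifferentiableAt ℂ f z) :
    (circle c R).integral f = (circle c r).integral f := by
  rw [circle_integral, circle_integral]
  refine Complex.circleIntegral_eq_of_differentiable_on_annulus_off_countable h0 hle
    countable_empty (fun z hz => (hf z hz).continuousAt.continuousWithinAt) fun z hz => ?_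
  exact hf z ⟨Metric.ball_subset_closedBall hz.1.1,
    fun h => hz.1.2 (Metric.ball_subset_closedBall h)⟩

variable {a b c d : ℝ}

theorem rect_integral_eq_zero [CompleteSpace E] (hab : a ≤ b) (hcd : c ≤ d) {f : ℂ → E}
    (hf : ∀ z : ℂ, z.re ∈ Icc a b → z.im ∈ Icc c d → DifferentiableAt ℂ f z) :
    (rect a b c d hab hcd).integral f = 0 := by
  have h := Complex.integral_boundary_rect_eq_zero_of_differentiableOn f ⟨a, c⟩ ⟨b, d⟩
    fun z hz => by
      simp only [Complex.mem_reProdIm, uIcc_of_le hab, uIcc_of_le hcd] at hz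
      exact (hf z hz.1 hz.2).differentiableWithinAt
  simp only at h
  rw [rect_integral, ← h]
  abel

theorem intervalIntegrable_horizontal {E : Type*} [NormedAddCommGroup E] {f : ℂ → E}
    (hab : a ≤ b)
    (hf : ∀ z : ℂ, z.re ∈ Icc a b → z.im = c → ContinuousAt f z) :
    IntervalIntegrable (fun x : ℝ => f (x + c * Complex.I)) volume a b := by
  refine ContinuousOn.intervalIntegrable fun x hx => ContinuousAt.continuousWithinAt ?_
  rw [uIcc_of_le hab] at hx
  exact (hf (x + c * Complex.I) (by simpa using hx) (by simp)).comp
    (f := fun x : ℝ => (x + c * Complex.I : ℂ)) (by fun_prop)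

theorem intervalIntegrable_vertical {E : Type*} [NormedAddCommGroup E] {f : ℂ → E}
    (hcd : c ≤ d)
    (hf : ∀ z : ℂ, z.re = a → z.im ∈ Icc c d → ContinuousAt f z) :
    IntervalIntegrable (fun y : ℝ => f (a + y * Complex.I)) volume c d := by
  refine ContinuousOn.intervalIntegrable fun y hy => ContinuousAt.continuousWithinAt ?_
  rw [uIcc_of_le hcd] at hy
  exact (hf (a + y * Complex.I) (by simp) (by simpa using hy)).comp
    (f := fun y : ℝ => (a + y * Complex.I : ℂ)) (by fun_prop)

theorem rect_integral_add_horizontal {m : ℝ} (ham : a ≤ m) (hmb : m ≤ b) (hcd : c ≤ d) {f : ℂ → E}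
    (hf : ∀ z : ℂ, z.re ∈ Icc a b → z.im = c ∨ z.im = d → ContinuousAt f z) :
    (rect a b c d (ham.trans hmb) hcd).integral f
      = (rect a m c d ham hcd).integral f + (rect m b c d hmb hcd).integral f := by
  have h : ∀ e, e = c ∨ e = d → (∫ x in a..b, f (x + e * Complex.I))
      = (∫ x in a..m, f (x + e * Complex.I)) + ∫ x in m..b, f (x + e * Complex.I) := by
    intro e he
    refine (intervalIntegral.integral_add_adjacent_intervals
      (intervalIntegrable_horizontal ham fun z hz hz' => hf z ⟨hz.1, hz.2.trans hmb⟩ ?_)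
      (intervalIntegrable_horizontal hmb fun z hz hz' => hf z ⟨ham.trans hz.1, hz.2⟩ ?_)).symm <;>
    rwa [hz']
  simp only [rect_integral, h c (.inl rfl), h d (.inr rfl)]
  abel

theorem rect_integral_add_vertical {m : ℝ} (hab : a ≤ b) (hcm : c ≤ m) (hmd : m ≤ d) {f : ℂ → E}
    (hf : ∀ z : ℂ, z.re = a ∨ z.re = b → z.im ∈ Icc c d → ContinuousAt f z) :
    (rect a b c d hab (hcm.trans hmd)).integral f
      = (rect a b c m hab hcm).integral f + (rect a b m d hab hmd).integral f := by
  have h : ∀ e, e = a ∨ e = b → (∫ y in c..d, f (e + y * Complex.I))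
      = (∫ y in c..m, f (e + y * Complex.I)) + ∫ y in m..d, f (e + y * Complex.I) := by
    intro e he
    refine (intervalIntegral.integral_add_adjacent_intervals
      (intervalIntegrable_vertical hcm fun z hz hz' => hf z ?_ ⟨hz'.1, hz'.2.trans hmd⟩)
      (intervalIntegrable_vertical hmd fun z hz hz' => hf z ?_ ⟨hcm.trans hz'.1, hz'.2⟩)).symm <;>
    rwa [hz]
  simp only [rect_integral, h a (.inl rfl), h b (.inr rfl), smul_add]
  abel

/-- The outer rectangle is cut into left, right, bottom and top pieces and the inner rectangle;
Cauchy's theorem kills the four outer pieces. -/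
theorem rect_integral_eq_of_shell [CompleteSpace E] {a' b' c' d' : ℝ} (ha : a ≤ a') (hab : a' ≤ b')
    (hb : b' ≤ b) (hc : c ≤ c') (hcd : c' ≤ d') (hd : d' ≤ d) {f : ℂ → E}
    (hf : ∀ z : ℂ, z.re ∈ Icc a b → z.im ∈ Icc c d →
      ¬(z.re ∈ Ioo a' b' ∧ z.im ∈ Ioo c' d') → DifferentiableAt ℂ f z) :
    (rect a b c d (ha.trans (hab.trans hb)) (hc.trans (hcd.trans hd))).integral f
      = (rect a' b' c' d' hab hcd).integral f := by
  have hfc : ∀ z : ℂ, z.re ∈ Icc a b → z.im ∈ Icc c d →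
      ¬(z.re ∈ Ioo a' b' ∧ z.im ∈ Ioo c' d') → ContinuousAt f z :=
    fun z h1 h2 h3 => (hf z h1 h2 h3).continuousAt
  rw [rect_integral_add_horizontal ha (hab.trans hb) (hc.trans (hcd.trans hd))
      fun z h1 h2 => hfc z h1 (by grind) (by grind),
    rect_integral_add_horizontal hab hb (hc.trans (hcd.trans hd))
      fun z h1 h2 => hfc z (by grind) (by grind) (by grind),
    rect_integral_add_vertical hab hc (hcd.trans hd)
      fun z h1 h2 => hfc z (by grind) (by grind) (by grind),
    rect_integral_add_vertical hab hcd hd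
      fun z h1 h2 => hfc z (by grind) (by grind) (by grind),
    rect_integral_eq_zero ha, rect_integral_eq_zero hb, rect_integral_eq_zero hab hc,
    rect_integral_eq_zero hab hd]
  · abel
  all_goals exact fun z h1 h2 => hf z (by grind) (by grind) (by grind)

theorem rect_index_of_notMem (hab : a ≤ b) (hcd : c ≤ d) {w : ℂ}
    (hw : ¬(w.re ∈ Icc a b ∧ w.im ∈ Icc c d)) : (rect a b c d hab hcd).index w = 0 := by
  refine rect_integral_eq_zero hab hcd fun z h1 h2 => ?_
  refine (differentiableAt_id.sub_const w).inv fun h => hw ?_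
  rw [← sub_eq_zero.1 h]
  exact ⟨h1, h2⟩

/-- The principal branch of `log (z - w)` is a primitive on the bottom, right and top sides, but its
cut crosses the left side. There `log (w - z)` serves instead, and the two branches differ by `πi`
and `-πi` at the lower and upper left corners, which adds up to `2πi`. -/
theorem rect_index_of_mem (hab : a ≤ b) (hcd : c ≤ d) {w : ℂ}
    (hw : w.re ∈ Ioo a b ∧ w.im ∈ Ioo c d) :
    (rect a b c d hab hcd).index w = 2 * Real.pi * Complex.I := by
  have hlog : ∀ z : ℂ, z - w ∈ Complex.slitPlane →
      HasDerivAt (fun z => Complex.log (z - w)) (z - w)⁻¹ z := fun z hz => by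
    simpa using ((hasDerivAt_id z).sub_const w).clog hz
  have hlog' : ∀ z : ℂ, w - z ∈ Complex.slitPlane →
      HasDerivAt (fun z => Complex.log (w - z)) (z - w)⁻¹ z := fun z hz => by
    have := ((hasDerivAt_id z).const_sub w).clog hz
    rwa [id, neg_div, ← div_neg, neg_sub, one_div] at this
  have hmain : ∀ (L : ℂ → ℂ) (γ : ℝ → ℂ) (v : ℂ) (p q : ℝ), p ≤ q →
      (∀ t, HasDerivAt γ v t) →
      (∀ t ∈ Icc p q, γ t - w ≠ 0) →
      (∀ t ∈ Icc p q, HasDerivAt L (γ t - w)⁻¹ (γ t)) →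
      v * ∫ t in p..q, (γ t - w)⁻¹ = L (γ q) - L (γ p) := by
    intro L γ v p q hpq hγ hne hL
    have hγc : Continuous γ := continuous_iff_continuousAt.2 fun t => (hγ t).continuousAt
    have h := intervalIntegral.integral_eq_sub_of_hasDerivAt (a := p) (b := q)
      (f := fun t => L (γ t)) (f' := fun t => (γ t - w)⁻¹ * v)
      (fun t ht => by
        rw [uIcc_of_le hpq] at ht
        exact (hL t ht).comp_of_eq t (hγ t) rfl)
      (by
        refine ContinuousOn.intervalIntegrable ?_
        rw [uIcc_of_le hpq]
        exact ((hγc.sub continuous_const).continuousOn.inv₀ hne).mul continuousOn_const)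
    rw [← h, intervalIntegral.integral_mul_const, mul_comm]
  have hH : ∀ (y t : ℝ), HasDerivAt (fun x : ℝ => (x + y * Complex.I : ℂ)) 1 t := fun y t =>
    (Complex.ofRealCLM.hasDerivAt (x := t)).add_const _
  have hV : ∀ (x t : ℝ), HasDerivAt (fun y : ℝ => (x + y * Complex.I : ℂ)) Complex.I t := by
    intro x t
    simpa using ((Complex.ofRealCLM.hasDerivAt (x := t)).mul_const Complex.I).const_add (x : ℂ)
  obtain ⟨⟨h1, h2⟩, h3, h4⟩ := hw
  have hne : ∀ z : ℂ, (z - w) ∈ Complex.slitPlane → z - w ≠ 0 := fun z hz =>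
    Complex.slitPlane_ne_zero hz
  have i1 := hmain (fun z => Complex.log (z - w)) (fun x => x + c * Complex.I) 1 a b hab (hH c)
    (fun t _ => hne _ (.inr (by simp; intro; linarith)))
    fun t _ => hlog _ (.inr (by simp; intro; linarith))
  have i2 := hmain (fun z => Complex.log (z - w)) (fun y => b + y * Complex.I) Complex.I c d hcd
    (hV b) (fun t _ => hne _ (.inl (by simp; linarith))) fun t _ => hlog _ (.inl (by simp; linarith))
  have i3 := hmain (fun z => Complex.log (z - w)) (fun x => x + d * Complex.I) 1 a b hab (hH d)
    (fun t _ => hne _ (.inr (by simp; intro; linarith)))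
    fun t _ => hlog _ (.inr (by simp; intro; linarith))
  have i4 := hmain (fun z => Complex.log (w - z)) (fun y => a + y * Complex.I) Complex.I c d hcd
    (hV a) (fun t _ => by
      rw [← neg_sub, neg_ne_zero]
      exact Complex.slitPlane_ne_zero (.inl (by simp; linarith)))
    fun t _ => hlog' _ (.inl (by simp; linarith))
  have j1 : Complex.log (w - (a + c * Complex.I))
      = Complex.log (a + c * Complex.I - w) + Real.pi * Complex.I := by
    rw [← neg_sub, Complex.log, Complex.log, norm_neg,
      Complex.arg_neg_eq_arg_add_pi_of_im_neg (by simp; linarith)]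
    push_cast
    ring
  have j2 : Complex.log (w - (a + d * Complex.I))
      = Complex.log (a + d * Complex.I - w) - Real.pi * Complex.I := by
    rw [← neg_sub, Complex.log, Complex.log, norm_neg,
      Complex.arg_neg_eq_arg_sub_pi_of_im_pos (by simp; linarith)]
    push_cast
    ring
  rw [one_mul] at i1 i3
  simp only [j1, j2] at i4
  rw [index, rect_integral, smul_eq_mul, smul_eq_mul, i1, i2, i3, i4]
  ring

end Contour
end LocalFormSub

namespace LocalFormSub

open Set

/-! ### Ranks of nearby projections. -/

section Rank

variable {H : Type*} [NormedAddCommGroup H] [InnerProductSpace ℂ H]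

/-- `P` is injective on the range of `Q`: if `P` kills `Q y`, then `‖Q y‖ = ‖(P - Q) (Q y)‖ ≤ ‖P -
Q‖ ‖Q y‖`. No finiteness enters, so the comparison holds for cardinals. -/
theorem opRank_le_of_norm_sub_lt_one {P Q : H →L[ℂ] H} (hQ : IsIdempotentElem Q)
    (h : ‖P - Q‖ < 1) : opRank Q ≤ opRank P := by
  have hinj : Function.Injective
      ((P : H →ₗ[ℂ] H).rangeRestrict.comp (LinearMap.range (Q : H →ₗ[ℂ] H)).subtype) := by
    rw [← LinearMap.ker_eq_bot, LinearMap.ker_eq_bot']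
    rintro ⟨x, y, rfl⟩ hx
    have hx' : P (Q y) = 0 := congrArg Subtype.val hx
    have hQy : Q (Q y) = Q y := congrArg (fun T : H →L[ℂ] H => T y) hQ
    have hle : ‖Q y‖ ≤ ‖P - Q‖ * ‖Q y‖ := by
      have := (P - Q).le_opNorm (Q y)
      rwa [sub_apply, hx', hQy, zero_sub, norm_neg] at this
    have h0 : ‖Q y‖ = 0 := by nlinarith [norm_nonneg (Q y)]
    exact Subtype.ext (norm_eq_zero.1 h0)
  exact LinearMap.rank_le_of_injective _ hinj

theorem opRank_eq_of_norm_sub_lt_one {P Q : H →L[ℂ] H} (hP : IsIdempotentElem P)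
    (hQ : IsIdempotentElem Q) (h : ‖P - Q‖ < 1) : opRank P = opRank Q :=
  le_antisymm (opRank_le_of_norm_sub_lt_one hP (by rwa [norm_sub_rev]))
    (opRank_le_of_norm_sub_lt_one hQ h)

theorem opRank_eq_of_continuousOn {p : ℝ → H →L[ℂ] H} (hp : ContinuousOn p (Icc 0 1))
    (hi : ∀ s ∈ Icc (0 : ℝ) 1, IsIdempotentElem (p s)) : opRank (p 1) = opRank (p 0) := by
  refine isPreconnected_Icc.induction₂ (fun s t => opRank (p s) = opRank (p t))
    (fun s hs => ?_) (fun _ _ _ _ _ _ h1 h2 => h1.trans h2) (fun _ _ _ _ h => h.symm)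
    (right_mem_Icc.2 zero_le_one) (left_mem_Icc.2 zero_le_one)
  filter_upwards [Metric.tendsto_nhds.1 (hp s hs) 1 one_pos, self_mem_nhdsWithin] with t ht ht'
  rw [dist_comm, dist_eq_norm] at ht
  exact opRank_eq_of_norm_sub_lt_one (hi s hs) (hi t ht') ht

end Rank

/-! ### Spectral resolution of the bounded inverse by continuous functional calculus. -/

variable {H : Type*} [NormedAddCommGroup H] [InnerProductSpace ℂ H] [CompleteSpace H]

/-- `B` is the inverse of a positive self-adjoint operator with spectrum `{μ k}`. -/
structure IsInverseOfDiscrete (B : H →L[ℂ] H) (μ : ℕ → ℝ) : Prop where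
  isSelfAdjoint : IsSelfAdjoint B
  denseRange : DenseRange B
  spectrum_subset : ∀ x ∈ _root_.spectrum ℂ B, x = 0 ∨ ∃ j, x = (μ j : ℂ)⁻¹
  pos : 0 < μ 0
  strictMono : StrictMono μ
  tendsto : Tendsto μ atTop atTop

theorem two_mul_radius_le {μ : ℕ → ℝ} (hμ : StrictMono μ) {j n : ℕ} (h : j ≠ n) :
    2 * radius μ n ≤ |μ n - μ j| := by
  rcases lt_or_gt_of_ne h with h | h
  · obtain ⟨m, rfl⟩ : ∃ m, n = m + 1 := ⟨n - 1, by omega⟩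
    have h1 : μ j ≤ μ m := hμ.monotone (by omega)
    rw [radius]
    have := min_le_left (μ (m + 1) - μ m) (μ (m + 2) - μ (m + 1))
    have := le_abs_self (μ (m + 1) - μ j)
    linarith
  · have h1 : μ (n + 1) ≤ μ j := hμ.monotone (by omega)
    have h2 := neg_le_abs (μ n - μ j)
    cases n with
    | zero => rw [radius]; rw [zero_add] at h1; linarith
    | succ m =>
      rw [radius]
      have := min_le_right (μ (m + 1) - μ m) (μ (m + 2) - μ (m + 1))
      linarith

theorem radius_pos {μ : ℕ → ℝ} (hμ : StrictMono μ) (n : ℕ) : 0 < radius μ n := by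
  cases n with
  | zero => rw [radius]; linarith [hμ (show 0 < 1 by omega)]
  | succ m =>
    rw [radius]
    have h1 : μ m < μ (m + 1) := hμ (by omega)
    have h2 : μ (m + 1) < μ (m + 2) := hμ (by omega)
    exact half_pos (lt_min (by linarith) (by linarith))

/-- A continuous function that is `1` at `(μ k)⁻¹` and `0` at `0` and at `(μ j)⁻¹`, `j ≠ k`. -/
def bump (μ : ℕ → ℝ) (k : ℕ) (x : ℂ) : ℂ :=
  ((μ k * max 0 (‖x‖ - ‖(μ k : ℂ) * x - 1‖ / (2 * radius μ k)) : ℝ) : ℂ)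

theorem continuous_bump (μ : ℕ → ℝ) (k : ℕ) : Continuous (bump μ k) := by
  unfold bump
  fun_prop

theorem bump_zero {μ : ℕ → ℝ} (hμ : StrictMono μ) (k : ℕ) : bump μ k 0 = 0 := by
  have := radius_pos hμ k
  have h : (0 : ℝ) - 1 / (2 * radius μ k) ≤ 0 := by
    rw [zero_sub]
    exact neg_nonpos.2 (by positivity)
  simp only [bump, norm_zero, mul_zero, zero_sub, norm_neg, norm_one] at h ⊢
  rw [max_eq_left h, mul_zero, Complex.ofReal_zero]

/-- For `j ≠ k` the gap `|μ k - μ j| ≥ 2 r_k` makes the second argument of the maximum nonpositive.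
So `bump μ k` agrees on the spectrum of `B` with the indicator of `(μ k)⁻¹`, while being continuous
everywhere. -/
theorem bump_inv {μ : ℕ → ℝ} (h0 : 0 < μ 0) (hμ : StrictMono μ) (k j : ℕ) :
    bump μ k (μ j : ℂ)⁻¹ = if j = k then 1 else 0 := by
  have hpos : ∀ n, 0 < μ n := fun n => h0.trans_le (hμ.monotone n.zero_le)
  have hj := hpos j
  have hk := hpos k
  have hr := radius_pos hμ k
  have h1 : ‖(μ j : ℂ)⁻¹‖ = (μ j)⁻¹ := by
    rw [norm_inv, Complex.norm_real, Real.norm_of_nonneg hj.le]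
  have h2 : ‖(μ k : ℂ) * (μ j : ℂ)⁻¹ - 1‖ = |μ k - μ j| / μ j := by
    rw [← Complex.ofReal_inv, ← Complex.ofReal_mul, ← Complex.ofReal_one, ← Complex.ofReal_sub,
      Complex.norm_real, Real.norm_eq_abs,
      show μ k * (μ j)⁻¹ - 1 = (μ k - μ j) / μ j by field_simp, abs_div, abs_of_pos hj]
  rw [bump, h1, h2]
  split_ifs with h
  · subst h
    rw [sub_self, abs_zero, zero_div, zero_div, sub_zero, max_eq_right (by positivity),
      mul_inv_cancel₀ hj.ne', Complex.ofReal_one]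
  · have := two_mul_radius_le hμ h
    have h3 : (μ j)⁻¹ - |μ k - μ j| / μ j / (2 * radius μ k) ≤ 0 := by
      rw [sub_nonpos, le_div_iff₀ (by positivity), div_eq_inv_mul]
      exact mul_le_mul_of_nonneg_left this (by positivity)
    rw [max_eq_left h3, mul_zero, Complex.ofReal_zero]

theorem isSelfAdjoint_cfc {f : ℂ → ℂ} {B : H →L[ℂ] H}
    (hf : ∀ x, star (f x) = f x) : IsSelfAdjoint (cfc f B) := by
  rw [IsSelfAdjoint, ← cfc_star]
  simp only [hf]

/-- The spectral projection of the bounded operator `B` at `(μ k)⁻¹`. -/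
def eigenProj (B : H →L[ℂ] H) (μ : ℕ → ℝ) (k : ℕ) : H →L[ℂ] H := cfc (bump μ k) B

theorem isSelfAdjoint_eigenProj (B : H →L[ℂ] H) (μ : ℕ → ℝ) (k : ℕ) :
    IsSelfAdjoint (eigenProj B μ k) :=
  isSelfAdjoint_cfc fun _ => Complex.conj_ofReal _

namespace IsInverseOfDiscrete

variable {B : H →L[ℂ] H} {μ : ℕ → ℝ} (hB : IsInverseOfDiscrete B μ)
include hB

theorem mu_pos (n : ℕ) : 0 < μ n := hB.pos.trans_le (hB.strictMono.monotone n.zero_le)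

theorem bump_eq (k : ℕ) {x : ℂ} (hx : x ∈ _root_.spectrum ℂ B) :
    bump μ k x = if x = (μ k : ℂ)⁻¹ then 1 else 0 := by
  rcases hB.spectrum_subset x hx with rfl | ⟨j, rfl⟩
  · rw [bump_zero hB.strictMono, if_neg]
    exact (inv_ne_zero (Complex.ofReal_ne_zero.2 (hB.mu_pos k).ne')).symm
  · rw [bump_inv hB.pos hB.strictMono]
    simp [hB.strictMono.injective.eq_iff]

theorem cfc_mul_eigenProj {f : ℂ → ℂ} (hf : ContinuousOn f (_root_.spectrum ℂ B)) (k : ℕ) :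
    cfc f B * eigenProj B μ k = f (μ k : ℂ)⁻¹ • eigenProj B μ k := by
  have := hB.isSelfAdjoint
  have hc : ContinuousOn (bump μ k) (_root_.spectrum ℂ B) := (continuous_bump μ k).continuousOn
  rw [eigenProj, ← cfc_mul f (bump μ k) B hf hc, ← cfc_const_mul _ _ B hc]
  refine cfc_congr fun x hx => ?_
  simp only [hB.bump_eq k hx]
  split_ifs with h
  · rw [h]
  · simp

theorem eigenProj_mul_cfc {f : ℂ → ℂ} (hf : ContinuousOn f (_root_.spectrum ℂ B)) (k : ℕ) :
    eigenProj B μ k * cfc f B = f (μ k : ℂ)⁻¹ • eigenProj B μ k := by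
  rw [← hB.cfc_mul_eigenProj hf]
  exact cfc_commute_cfc _ _ _

theorem eigenProj_mul_self (k : ℕ) :
    eigenProj B μ k * eigenProj B μ k = eigenProj B μ k := by
  conv_lhs => enter [1]; rw [eigenProj]
  rw [hB.cfc_mul_eigenProj (continuous_bump μ k).continuousOn,
    bump_inv hB.pos hB.strictMono, if_pos rfl, one_smul]

theorem eigenProj_mul_of_ne {j k : ℕ} (h : j ≠ k) : eigenProj B μ j * eigenProj B μ k = 0 := by
  conv_lhs => enter [1]; rw [eigenProj]
  rw [hB.cfc_mul_eigenProj (continuous_bump μ j).continuousOn,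
    bump_inv hB.pos hB.strictMono, if_neg h.symm, zero_smul]

theorem sum_eigenProj (s : Finset ℕ) :
    ∑ j ∈ s, eigenProj B μ j = cfc (fun x => ∑ j ∈ s, bump μ j x) B := by
  have := hB.isSelfAdjoint
  have h := cfc_sum (bump μ) B s fun j _ => (continuous_bump μ j).continuousOn
  rw [show (fun x => ∑ j ∈ s, bump μ j x) = ∑ j ∈ s, bump μ j from
    funext fun x => (Finset.sum_apply x s _).symm, h]
  rfl

theorem sum_bump (s : Finset ℕ) {x : ℂ} (hx : x ∈ _root_.spectrum ℂ B) :
    ∑ j ∈ s, bump μ j x = if ∃ j ∈ s, x = (μ j : ℂ)⁻¹ then 1 else 0 := by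
  rw [Finset.sum_congr rfl fun j _ => hB.bump_eq j hx]
  split_ifs with h
  · obtain ⟨j, hj, rfl⟩ := h
    rw [Finset.sum_eq_single j]
    · simp
    · intro i _ hi
      rw [if_neg]
      simpa [hB.strictMono.injective.eq_iff] using hi.symm
    · exact fun h => absurd hj h
  · exact Finset.sum_eq_zero fun j hj => if_neg fun hx => h ⟨j, hj, hx⟩

theorem one_sub_sum_eigenProj (s : Finset ℕ) :
    1 - ∑ j ∈ s, eigenProj B μ j = cfc (fun x => 1 - ∑ j ∈ s, bump μ j x) B := by
  have := hB.isSelfAdjoint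
  have hc : ContinuousOn (fun x => ∑ j ∈ s, bump μ j x) (_root_.spectrum ℂ B) :=
    (continuous_finsetSum _ fun j _ => continuous_bump μ j).continuousOn
  rw [hB.sum_eigenProj, cfc_sub (fun _ => 1) _ B continuousOn_const hc, cfc_const_one ℂ B]

theorem norm_sum_eigenProj_le (s : Finset ℕ) : ‖∑ j ∈ s, eigenProj B μ j‖ ≤ 1 := by
  rw [hB.sum_eigenProj]
  refine norm_cfc_le zero_le_one fun x hx => ?_
  rw [hB.sum_bump s hx]
  split_ifs <;> simp

theorem norm_one_sub_sum_eigenProj_le (s : Finset ℕ) : ‖1 - ∑ j ∈ s, eigenProj B μ j‖ ≤ 1 := by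
  rw [hB.one_sub_sum_eigenProj]
  refine norm_cfc_le zero_le_one fun x hx => ?_
  rw [hB.sum_bump s hx]
  split_ifs <;> simp

theorem norm_one_sub_sum_eigenProj_mul_le {s : Finset ℕ} {n : ℕ} (hs : Finset.range n ⊆ s) :
    ‖(1 - ∑ j ∈ s, eigenProj B μ j) * B‖ ≤ (μ n)⁻¹ := by
  have := hB.isSelfAdjoint
  have hc : ContinuousOn (fun x => 1 - ∑ j ∈ s, bump μ j x) (_root_.spectrum ℂ B) :=
    (continuous_const.sub (continuous_finsetSum _ fun j _ => continuous_bump μ j)).continuousOn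
  have hn := hB.mu_pos n
  rw [hB.one_sub_sum_eigenProj]
  nth_rw 2 [← cfc_id ℂ B]
  rw [← cfc_mul _ _ B hc continuousOn_id]
  refine norm_cfc_le (by positivity) fun x hx => ?_
  rw [hB.sum_bump s hx]
  split_ifs with h
  · simp [hn.le]
  · rw [sub_zero, one_mul, id]
    rcases hB.spectrum_subset x hx with rfl | ⟨j, rfl⟩
    · simp [hn.le]
    · rw [norm_inv, Complex.norm_real, Real.norm_of_nonneg (hB.mu_pos j).le]
      refine inv_anti₀ hn (hB.strictMono.monotone ?_)
      by_contra! hj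
      exact h ⟨j, hs (Finset.mem_range.2 hj), rfl⟩

/-- On the range of `B` the remainder after the first `n` projections has size `O((μ n)⁻¹)`. This
range is dense and the remainders are uniformly bounded by `1`, so the convergence extends to every
vector. -/
theorem hasSum_eigenProj (x : H) : HasSum (fun j => eigenProj B μ j x) x := by
  rw [HasSum, SummationFilter.unconditional_filter, Metric.tendsto_atTop]
  intro ε hε
  obtain ⟨_, ⟨y, rfl⟩, hy⟩ := Metric.mem_closure_iff.1 (hB.denseRange x) (ε / 2) (half_pos hε)
  have ht : Tendsto (fun n => (μ n)⁻¹ * ‖y‖) atTop (𝓝 0) := by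
    simpa using hB.tendsto.inv_tendsto_atTop.mul_const ‖y‖
  obtain ⟨n, hn⟩ := (ht.eventually_lt_const (half_pos hε)).exists
  refine ⟨Finset.range n, fun s hs => ?_⟩
  set E : H →L[ℂ] H := ∑ j ∈ s, eigenProj B μ j with hE
  have hsum : ∑ j ∈ s, eigenProj B μ j x = E x := by
    rw [hE, sum_apply]
  have hsplit : x - E x = (1 - E) (x - B y) + ((1 - E) * B) y := by
    rw [ContinuousLinearMap.mul_def, ContinuousLinearMap.comp_apply, ← map_add, sub_add_cancel]
    simp
  rw [hsum, dist_comm, dist_eq_norm, hsplit]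
  refine (norm_add_le _ _).trans_lt ?_
  have h1 : ‖(1 - E) (x - B y)‖ < ε / 2 := by
    refine ((1 - E).le_of_opNorm_le (hB.norm_one_sub_sum_eigenProj_le s) _).trans_lt ?_
    rwa [one_mul, ← dist_eq_norm]
  have h2 : ‖((1 - E) * B) y‖ < ε / 2 :=
    (((1 - E) * B).le_of_opNorm_le (hB.norm_one_sub_sum_eigenProj_mul_le hs) _).trans_lt hn
  linarith

/-- Bessel's inequality: for self-adjoint idempotents the left side is `⟨x, E x⟩` with `E` their
sum, and `‖E‖ ≤ 1`. -/
theorem sum_norm_eigenProj_sq_le (s : Finset ℕ) (x : H) :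
    ∑ j ∈ s, ‖eigenProj B μ j x‖ ^ 2 ≤ ‖x‖ ^ 2 := by
  have h : ∀ j, ((‖eigenProj B μ j x‖ ^ 2 : ℝ) : ℂ) = inner ℂ x (eigenProj B μ j x) := by
    intro j
    have hs := ContinuousLinearMap.isSelfAdjoint_iff'.1 (isSelfAdjoint_eigenProj B μ j)
    calc ((‖eigenProj B μ j x‖ ^ 2 : ℝ) : ℂ)
        = inner ℂ (eigenProj B μ j x) (eigenProj B μ j x) := by
          rw [inner_self_eq_norm_sq_to_K]; norm_cast
      _ = inner ℂ x ((eigenProj B μ j * eigenProj B μ j) x) := by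
          conv_lhs => enter [2]; rw [← hs]
          rw [ContinuousLinearMap.adjoint_inner_left, ContinuousLinearMap.mul_def,
            ContinuousLinearMap.comp_apply]
      _ = _ := by rw [hB.eigenProj_mul_self]
  have h2 : ((∑ j ∈ s, ‖eigenProj B μ j x‖ ^ 2 : ℝ) : ℂ)
      = inner ℂ x ((∑ j ∈ s, eigenProj B μ j) x) := by
    rw [Complex.ofReal_sum, sum_apply, inner_sum]
    exact Finset.sum_congr rfl fun j _ => h j
  have h3 : ‖inner ℂ x ((∑ j ∈ s, eigenProj B μ j) x)‖ ≤ ‖x‖ ^ 2 := by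
    refine (norm_inner_le_norm _ _).trans ?_
    rw [sq]
    refine mul_le_mul_of_nonneg_left ?_ (norm_nonneg _)
    simpa using (∑ j ∈ s, eigenProj B μ j).le_of_opNorm_le (hB.norm_sum_eigenProj_le s) x
  rw [← h2, Complex.norm_real] at h3
  exact (le_abs_self _).trans h3

theorem ext_of_mul_eigenProj {X Y : H →L[ℂ] H}
    (h : ∀ j, X * eigenProj B μ j = Y * eigenProj B μ j) : X = Y := by
  ext x
  have hX := X.hasSum (hB.hasSum_eigenProj x)
  have hY := Y.hasSum (hB.hasSum_eigenProj x)
  refine hX.unique ?_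
  convert hY using 2 with j
  exact congrArg (fun T : H →L[ℂ] H => T x) (h j)

end IsInverseOfDiscrete

end LocalFormSub

/-! ### Resolvents, the bounded inverse and its square root. -/

namespace LocalFormSub

open Set

variable {H : Type*} [NormedAddCommGroup H] [InnerProductSpace ℂ H] [CompleteSpace H]

section Resolvent

variable {H : Type*} [NormedAddCommGroup H] [InnerProductSpace ℂ H]

theorem IsResolventAt.unique {T : H →ₗ.[ℂ] H} {z : ℂ} {R S : H →L[ℂ] H}
    (hR : IsResolventAt T z R) (hS : IsResolventAt T z S) : R = S := by
  ext x
  obtain ⟨y, hy, hy'⟩ := hR.1 x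
  rw [← hy, ← hS.2 y, hy']

theorem IsResolventAt.resolvent_eq {T : H →ₗ.[ℂ] H} {z : ℂ} {R : H →L[ℂ] H}
    (hR : IsResolventAt T z R) : resolvent T z = R := by
  have h : ∃ R : H →L[ℂ] H, IsResolventAt T z R := ⟨R, hR⟩
  rw [resolvent, dif_pos h]
  exact h.choose_spec.unique hR

/-- `B` is a bounded everywhere defined inverse of `A`. -/
structure IsBoundedInverse (A : H →ₗ.[ℂ] H) (B : H →L[ℂ] H) : Prop where
  apply_eq : ∀ x : H, ∃ y : A.domain, (y : H) = B x ∧ A y = x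
  eq_apply : ∀ y : A.domain, B (A y) = y

theorem IsBoundedInverse.smul_mul_eq {A : H →ₗ.[ℂ] H} {B R : H →L[ℂ] H} {z : ℂ}
    (hB : IsBoundedInverse A B) (hR : IsResolventAt A z R) (x : H) :
    z • B (R x) = B x + R x := by
  obtain ⟨y, hy, hy'⟩ := hR.1 x
  have h : B x = z • B y - y := by
    rw [← hy', map_sub, map_smul, hB.eq_apply]
  rw [h, hy]
  abel

theorem IsBoundedInverse.smul_mul_eq' {A : H →ₗ.[ℂ] H} {B R : H →L[ℂ] H} {z : ℂ}
    (hB : IsBoundedInverse A B) (hR : IsResolventAt A z R) (x : H) :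
    z • R (B x) = B x + R x := by
  obtain ⟨y, hy, hy'⟩ := hB.apply_eq x
  have h := hR.2 y
  rwa [hy, hy', map_sub, map_smul, sub_eq_iff_eq_add] at h

theorem IsBoundedInverse.isUnit_sub {A : H →ₗ.[ℂ] H} {B R : H →L[ℂ] H} {z : ℂ}
    (hB : IsBoundedInverse A B) (hR : IsResolventAt A z R) (hz : z ≠ 0) :
    IsUnit (algebraMap ℂ (H →L[ℂ] H) z⁻¹ - B) := by
  have h1 : ∀ x, B (R x) = z⁻¹ • (B x + R x) := fun x => by
    rw [← hB.smul_mul_eq hR, inv_smul_smul₀ hz]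
  have h2 : ∀ x, R (B x) = z⁻¹ • (B x + R x) := fun x => by
    rw [← hB.smul_mul_eq' hR, inv_smul_smul₀ hz]
  -- Formally `(z⁻¹ - A⁻¹)⁻¹ = -z A R`, and `A R = z R - 1`.
  refine isUnit_iff_exists.2 ⟨z • (1 - z • R), ?_, ?_⟩ <;> ext x <;>
    simp only [Algebra.algebraMap_eq_smul_one, mul_apply_eq_comp, sub_apply, smul_apply,
      one_apply_eq_self, map_smul, map_sub, h1, h2] <;>
    match_scalars <;> field_simp <;> ring

theorem exists_isBoundedInverse {A : H →ₗ.[ℂ] H} {μ : ℕ → ℝ} (hμ : HasSpectrumSeq A μ) :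
    ∃ B : H →L[ℂ] H, IsBoundedInverse A B := by
  have h0 : (0 : ℂ) ∈ resolventSet A := by
    by_contra h
    have h' : (0 : ℂ) ∈ spectrum A := h
    rw [hμ.1] at h'
    obtain ⟨k, hk⟩ := h'
    have : 0 < μ k := hμ.2.1.trans_le (hμ.2.2.1.monotone k.zero_le)
    exact this.ne' (Complex.ofReal_eq_zero.1 hk)
  obtain ⟨R, hR⟩ := h0
  refine ⟨-R, fun x => ?_, fun y => ?_⟩
  · obtain ⟨y, hy, hy'⟩ := hR.1 x
    refine ⟨-y, by simp [hy], ?_⟩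
    rw [LinearPMap.map_neg, ← hy', zero_smul, zero_sub]
  · have := hR.2 y
    rwa [zero_smul, zero_sub, map_neg] at this

end Resolvent

theorem isFormalAdjoint_self {A : H →ₗ.[ℂ] H} (hA : IsSelfAdjoint A) (x y : A.domain) :
    inner ℂ (A x) (y : H) = inner ℂ (x : H) (A y) := by
  have h := A.adjoint_isFormalAdjoint hA.dense_domain
  rw [LinearPMap.isSelfAdjoint_def.1 hA] at h
  exact h x y

theorem IsBoundedInverse.isInverseOfDiscrete {A : H →ₗ.[ℂ] H} {B : H →L[ℂ] H} {μ : ℕ → ℝ}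
    (hB : IsBoundedInverse A B) (hA : IsSelfAdjoint A) (hμ : HasSpectrumSeq A μ) :
    IsInverseOfDiscrete B μ where
  isSelfAdjoint := by
    rw [ContinuousLinearMap.isSelfAdjoint_iff_isSymmetric]
    intro x y
    obtain ⟨u, hu, hu'⟩ := hB.apply_eq x
    obtain ⟨w, hw, hw'⟩ := hB.apply_eq y
    have := isFormalAdjoint_self hA u w
    rw [hu', hw', hu, hw] at this
    exact this.symm
  denseRange := by
    refine hA.dense_domain.mono fun x hx => ⟨A ⟨x, hx⟩, hB.eq_apply ⟨x, hx⟩⟩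
  spectrum_subset x hx := by
    by_contra! h
    have hz : x⁻¹ ∈ resolventSet A := by
      by_contra hz
      have hz' : x⁻¹ ∈ spectrum A := hz
      rw [hμ.1] at hz'
      obtain ⟨k, hk⟩ := hz'
      exact h.2 k (by rw [show (μ k : ℂ) = x⁻¹ from hk, inv_inv])
    obtain ⟨R, hR⟩ := hz
    have := hB.isUnit_sub hR (inv_ne_zero h.1)
    rw [inv_inv] at this
    exact hx this
  pos := hμ.2.1
  strictMono := hμ.2.2.1
  tendsto := hμ.2.2.2

/-- The square root of a bounded positive operator. -/
def sqrtBounded (B : H →L[ℂ] H) : H →L[ℂ] H := cfc (fun x : ℂ => ((Real.sqrt ‖x‖ : ℝ) : ℂ)) B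

theorem continuous_sqrt_norm : Continuous fun x : ℂ => ((Real.sqrt ‖x‖ : ℝ) : ℂ) := by fun_prop

theorem isSelfAdjoint_sqrtBounded (B : H →L[ℂ] H) : IsSelfAdjoint (sqrtBounded B) :=
  isSelfAdjoint_cfc fun _ => Complex.conj_ofReal _

theorem inner_sqrtBounded (B : H →L[ℂ] H) (x y : H) :
    inner ℂ (sqrtBounded B x) y = inner ℂ x (sqrtBounded B y) := by
  have h := ContinuousLinearMap.isSelfAdjoint_iff'.1 (isSelfAdjoint_sqrtBounded B)
  conv_lhs => rw [← h]
  rw [ContinuousLinearMap.adjoint_inner_left]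

namespace IsInverseOfDiscrete

variable {B : H →L[ℂ] H} {μ : ℕ → ℝ} (hB : IsInverseOfDiscrete B μ)
include hB

theorem sqrt_norm_inv (k : ℕ) :
    ((Real.sqrt ‖(μ k : ℂ)⁻¹‖ : ℝ) : ℂ) = ((Real.sqrt (μ k) : ℝ) : ℂ)⁻¹ := by
  rw [norm_inv, Complex.norm_real, Real.norm_of_nonneg (hB.mu_pos k).le, Real.sqrt_inv,
    Complex.ofReal_inv]

theorem sqrt_mu_ne_zero (k : ℕ) : ((Real.sqrt (μ k) : ℝ) : ℂ) ≠ 0 :=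
  Complex.ofReal_ne_zero.2 (Real.sqrt_pos.2 (hB.mu_pos k)).ne'

theorem eigenProj_sqrtBounded (k : ℕ) (x : H) :
    eigenProj B μ k (sqrtBounded B x) = ((Real.sqrt (μ k) : ℝ) : ℂ)⁻¹ • eigenProj B μ k x := by
  have h := hB.eigenProj_mul_cfc continuous_sqrt_norm.continuousOn k
  rw [hB.sqrt_norm_inv] at h
  exact congrArg (fun T : H →L[ℂ] H => T x) h

theorem sqrtBounded_eigenProj (k : ℕ) (x : H) :
    sqrtBounded B (eigenProj B μ k x) = ((Real.sqrt (μ k) : ℝ) : ℂ)⁻¹ • eigenProj B μ k x := by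
  have h := hB.cfc_mul_eigenProj continuous_sqrt_norm.continuousOn k
  rw [hB.sqrt_norm_inv] at h
  exact congrArg (fun T : H →L[ℂ] H => T x) h

theorem sqrtBounded_mul_self : sqrtBounded B * sqrtBounded B = B := by
  have := hB.isSelfAdjoint
  rw [sqrtBounded, ← cfc_mul _ _ B continuous_sqrt_norm.continuousOn
    continuous_sqrt_norm.continuousOn]
  conv_rhs => rw [← cfc_id ℂ B]
  refine cfc_congr fun x hx => ?_
  simp only [id]
  rw [← Complex.ofReal_mul, Real.mul_self_sqrt (norm_nonneg x)]
  rcases hB.spectrum_subset x hx with rfl | ⟨j, rfl⟩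
  · simp
  · rw [norm_inv, Complex.norm_real, Real.norm_of_nonneg (hB.mu_pos j).le, Complex.ofReal_inv]

theorem eq_zero_of_eigenProj {x : H} (h : ∀ j, eigenProj B μ j x = 0) : x = 0 := by
  have := hB.hasSum_eigenProj x
  simp only [h] at this
  exact this.unique hasSum_zero

theorem sqrtBounded_injective {x : H} (h : sqrtBounded B x = 0) : x = 0 := by
  refine hB.eq_zero_of_eigenProj fun j => ?_
  have := hB.eigenProj_sqrtBounded j x
  rw [h, map_zero] at this
  exact (smul_eq_zero.1 this.symm).resolve_left (inv_ne_zero (hB.sqrt_mu_ne_zero j))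

theorem mul_eigenProj (k : ℕ) : B * eigenProj B μ k = (μ k : ℂ)⁻¹ • eigenProj B μ k := by
  have := hB.isSelfAdjoint
  have h := hB.cfc_mul_eigenProj continuousOn_id k
  rwa [cfc_id ℂ B] at h

theorem isUnit_smul_sub_one {z : ℂ} (hz : ∀ j, z ≠ μ j) : IsUnit (z • B - 1) := by
  rcases eq_or_ne z 0 with rfl | h0
  · rw [zero_smul, zero_sub]
    exact isUnit_one.neg
  · have hx : z⁻¹ ∉ _root_.spectrum ℂ B := fun hx => by
      rcases hB.spectrum_subset _ hx with h | ⟨j, h⟩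
      · exact inv_ne_zero h0 h
      · exact hz j (inv_injective h)
    rw [spectrum.notMem_iff] at hx
    have h := (hx.smul (Units.mk0 (-z) (neg_ne_zero.2 h0)))
    rwa [Units.smul_def, Units.val_mk0, Algebra.algebraMap_eq_smul_one, smul_sub, smul_smul,
      neg_mul, mul_inv_cancel₀ h0, neg_smul, neg_smul, one_smul, sub_neg_eq_add, neg_add_eq_sub] at h

end IsInverseOfDiscrete

/-! ### The pencil and the unperturbed resolvent. -/

/-- The operator pencil `z B - 1 - K`. -/
def pencil (B K : H →L[ℂ] H) (z : ℂ) : H →L[ℂ] H := z • B - 1 - K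

/-- The operator function `B^{1/2} (z B - 1 - K)⁻¹ B^{1/2}`. -/
def pencilResolvent (B K : H →L[ℂ] H) (z : ℂ) : H →L[ℂ] H :=
  sqrtBounded B * Ring.inverse (pencil B K z) * sqrtBounded B

/-- On the domain of `A`, `z - A = (z B - 1) A`, so the resolvent is `B (z B - 1)⁻¹`. For `K = 0`
the square roots commute with the pencil and merge into `B`. -/
theorem IsBoundedInverse.isResolventAt {A : H →ₗ.[ℂ] H} {B : H →L[ℂ] H} {μ : ℕ → ℝ}
    (hAB : IsBoundedInverse A B) (hB : IsInverseOfDiscrete B μ) {z : ℂ} (hz : ∀ j, z ≠ μ j) :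
    IsResolventAt A z (pencilResolvent B 0 z) := by
  have := hB.isSelfAdjoint
  have hu := hB.isUnit_smul_sub_one hz
  set Q := Ring.inverse (z • B - 1) with hQ
  have hcomm : Commute (sqrtBounded B) Q := by
    have h1 : Commute (sqrtBounded B) (z • B - 1) := by
      refine (Commute.smul_right ?_ z).sub_right (Commute.one_right _)
      have h := (Commute.refl (sqrtBounded B)).mul_right (Commute.refl (sqrtBounded B))
      rwa [hB.sqrtBounded_mul_self] at h
    rw [hQ, ← hu.unit_spec, Ring.inverse_unit]
    rw [← hu.unit_spec] at h1
    exact h1.units_inv_right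
  have hR : pencilResolvent B 0 z = B * Q := by
    rw [pencilResolvent, pencil, sub_zero, mul_assoc, ← hcomm.eq, ← mul_assoc,
      hB.sqrtBounded_mul_self]
  have h1 : (z • B - 1) * Q = 1 := Ring.mul_inverse_cancel _ hu
  have h2 : Q * (z • B - 1) = 1 := Ring.inverse_mul_cancel _ hu
  rw [hR]
  refine ⟨fun x => ?_, fun y => ?_⟩
  · obtain ⟨y, hy, hy'⟩ := hAB.apply_eq (Q x)
    refine ⟨y, hy, ?_⟩
    rw [hy', hy]
    exact congrArg (fun T : H →L[ℂ] H => T x) h1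
  · have h : z • (y : H) - A y = (z • B - 1) (A y) := by
      rw [sub_apply, smul_apply, hAB.eq_apply, one_apply_eq_self]
    have h' : Q ((z • B - 1) (A y)) = A y := congrArg (fun T : H →L[ℂ] H => T (A y)) h2
    rw [h, mul_apply_eq_comp, h', hAB.eq_apply]

section Pencil

variable {B K : H →L[ℂ] H}

theorem differentiableAt_pencilResolvent {z : ℂ} (hz : IsUnit (pencil B K z)) :
    DifferentiableAt ℂ (pencilResolvent B K) z := by
  have h : DifferentiableAt ℂ (pencil B K) z := by
    unfold pencil
    fun_prop
  have h' : DifferentiableAt ℂ (Ring.inverse : (H →L[ℂ] H) → H →L[ℂ] H) (pencil B K z) := by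
    rw [← hz.unit_spec]
    exact (hasFDerivAt_ringInverse (𝕜 := ℂ) hz.unit).differentiableAt
  exact ((h'.comp z h).const_mul _).mul_const _

/-- Two pencils differ by `(w - z) B`, and `B = B^{1/2} B^{1/2}` supplies exactly the inner square
roots of the product. The identity thus needs no operator `T` behind it and is available for every
`s K`. -/
theorem pencilResolvent_sub (hG : sqrtBounded B * sqrtBounded B = B) {z w : ℂ}
    (hz : IsUnit (pencil B K z)) (hw : IsUnit (pencil B K w)) :
    pencilResolvent B K z - pencilResolvent B K w
      = (w - z) • (pencilResolvent B K z * pencilResolvent B K w) := by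
  simp only [pencilResolvent]
  set G := sqrtBounded B
  set Q := Ring.inverse (pencil B K z) with hQ
  set S := Ring.inverse (pencil B K w) with hS
  have h1 : Q * pencil B K z = 1 := Ring.inverse_mul_cancel _ hz
  have h2 : pencil B K w * S = 1 := Ring.mul_inverse_cancel _ hw
  have h3 : pencil B K w - pencil B K z = (w - z) • (G * G) := by
    rw [hG, pencil, pencil, sub_smul]
    abel
  have h4 : Q - S = Q * (pencil B K w - pencil B K z) * S := by
    rw [mul_sub, h1, sub_mul, one_mul, mul_assoc, h2, mul_one]
  calc G * Q * G - G * S * G = G * (Q - S) * G := by rw [mul_sub, sub_mul]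
    _ = _ := by
      rw [h4, h3]
      simp only [mul_smul_comm, smul_mul_assoc, mul_assoc]

end Pencil

namespace IsInverseOfDiscrete

variable {B : H →L[ℂ] H} {μ : ℕ → ℝ} (hB : IsInverseOfDiscrete B μ)
include hB

theorem pencilResolvent_zero_mul_eigenProj {z : ℂ} (hz : ∀ j, z ≠ μ j) (k : ℕ) :
    pencilResolvent B 0 z * eigenProj B μ k = (z - μ k)⁻¹ • eigenProj B μ k := by
  have hu := hB.isUnit_smul_sub_one hz
  have hk : z - μ k ≠ 0 := sub_ne_zero.2 (hz k)
  have hmu : (μ k : ℂ) ≠ 0 := Complex.ofReal_ne_zero.2 (hB.mu_pos k).ne'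
  have h1 : (z • B - 1) * eigenProj B μ k = ((z - μ k) / μ k) • eigenProj B μ k := by
    rw [sub_mul, smul_mul_assoc, hB.mul_eigenProj, one_mul]
    match_scalars
    field_simp
  have h2 : Ring.inverse (z • B - 1) * eigenProj B μ k
      = (μ k / (z - μ k)) • eigenProj B μ k := by
    have h3 : eigenProj B μ k = (μ k / (z - μ k)) • ((z • B - 1) * eigenProj B μ k) := by
      rw [h1, smul_smul, div_mul_div_cancel₀ hk, div_self hmu, one_smul]
    conv_lhs => rw [h3]
    rw [mul_smul_comm, ← mul_assoc, Ring.inverse_mul_cancel _ hu, one_mul]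
  have h4 : sqrtBounded B * eigenProj B μ k
      = ((Real.sqrt (μ k) : ℝ) : ℂ)⁻¹ • eigenProj B μ k := by
    ext x
    exact hB.sqrtBounded_eigenProj k x
  have h5 : ((Real.sqrt (μ k) : ℝ) : ℂ)⁻¹ * ((Real.sqrt (μ k) : ℝ) : ℂ)⁻¹ = (μ k : ℂ)⁻¹ := by
    rw [← mul_inv, ← Complex.ofReal_mul, Real.mul_self_sqrt (hB.mu_pos k).le]
  rw [pencilResolvent, pencil, sub_zero, mul_assoc, h4, mul_smul_comm, mul_assoc, h2,
    mul_smul_comm, h4, smul_smul, smul_smul, mul_right_comm, h5]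
  congr 1
  field_simp

/-- The unperturbed resolvent acts on the `k`-th eigenspace as `(z - μ k)⁻¹`, which integrates to a
winding number. Bounded operators agreeing on all eigenspaces are equal. -/
theorem integral_pencilResolvent_zero (c : Contour) (hc : ∀ z ∈ c.trace, ∀ j, z ≠ μ j)
    {s : Finset ℕ} (h1 : ∀ j ∈ s, c.index (μ j) = 2 * Real.pi * Complex.I)
    (h0 : ∀ j ∉ s, c.index (μ j) = 0) :
    (2 * Real.pi * Complex.I : ℂ)⁻¹ • c.integral (pencilResolvent B 0)
      = ∑ j ∈ s, eigenProj B μ j := by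
  have hcont : ContinuousOn (pencilResolvent B 0) c.trace := fun z hz =>
    (differentiableAt_pencilResolvent (by
      rw [pencil, sub_zero]
      exact hB.isUnit_smul_sub_one (hc z hz))).continuousAt.continuousWithinAt
  refine hB.ext_of_mul_eigenProj fun k => ?_
  have h : c.integral (pencilResolvent B 0) * eigenProj B μ k
      = c.index (μ k) • eigenProj B μ k := by
    refine (c.integral_map ((ContinuousLinearMap.mul ℂ (H →L[ℂ] H)).flip (eigenProj B μ k))
      hcont).symm.trans ?_
    rw [Contour.index, ← c.integral_smul_const]
    · exact c.integral_congr fun z hz => hB.pencilResolvent_zero_mul_eigenProj (hc z hz) k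
    · exact (continuous_id.sub continuous_const).continuousOn.inv₀ fun z hz =>
        sub_ne_zero.2 (hc z hz k)
  rw [smul_mul_assoc, h, Finset.sum_mul]
  by_cases hk : k ∈ s
  · rw [h1 k hk, smul_smul, inv_mul_cancel₀ Complex.two_pi_I_ne_zero, one_smul,
      Finset.sum_eq_single_of_mem k hk fun j _ hj => hB.eigenProj_mul_of_ne hj,
      hB.eigenProj_mul_self]
  · rw [h0 k hk, zero_smul, smul_zero, Finset.sum_eq_zero]
    intro j hj
    exact hB.eigenProj_mul_of_ne fun h => hk (h ▸ hj)

end IsInverseOfDiscrete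

theorem IsBoundedInverse.specProj_eq {A : H →ₗ.[ℂ] H} {B : H →L[ℂ] H} {μ : ℕ → ℝ}
    (hAB : IsBoundedInverse A B) (hB : IsInverseOfDiscrete B μ) (k : ℕ) :
    specProj A μ k = eigenProj B μ k := by
  have hr := radius_pos hB.strictMono k
  have hdist : ∀ j ≠ k, radius μ k < dist (μ j : ℂ) (μ k) := fun j hj => by
    rw [Complex.dist_of_im_eq (by simp), Complex.ofReal_re, Complex.ofReal_re, Real.dist_eq,
      abs_sub_comm]
    linarith [two_mul_radius_le hB.strictMono hj]
  have hc : ∀ z ∈ (Contour.circle (μ k) (radius μ k)).trace, ∀ j, z ≠ μ j := by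
    rintro z hz j rfl
    have h := Contour.circle_trace _ hr.le hz
    rw [mem_sphere_iff_norm, ← dist_eq_norm] at h
    rcases eq_or_ne j k with rfl | hj
    · rw [dist_self] at h
      exact hr.ne h
    · exact (hdist j hj).ne' h
  rw [specProj, circleProj, ← Contour.circle_integral,
    Contour.integral_congr _ (g := pencilResolvent B 0) fun z hz =>
      (hAB.isResolventAt hB (hc z hz)).resolvent_eq,
    hB.integral_pencilResolvent_zero _ hc (s := {k}), Finset.sum_singleton]
  · intro j hj
    rw [Finset.mem_singleton.1 hj]
    exact Contour.circle_index_of_mem_ball (Metric.mem_ball_self hr)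
  · intro j hj
    refine Contour.circle_index_of_notMem_closedBall hr.le ?_
    rw [Metric.mem_closedBall, not_le]
    exact hdist j (by simpa using hj)

/-- The series defining `A^{1/2} B^{1/2} u` is term by term the eigenfunction expansion of `u`. With
`sqrtBounded_sqrtOp` this identifies the form domain with the range of `B^{1/2}`. -/
theorem IsBoundedInverse.sqrtOp_spec {A : H →ₗ.[ℂ] H} {B : H →L[ℂ] H} {μ : ℕ → ℝ}
    (hAB : IsBoundedInverse A B) (hB : IsInverseOfDiscrete B μ) (u : H) :
    ∃ h : sqrtBounded B u ∈ formDomain A μ, sqrtOp A μ ⟨sqrtBounded B u, h⟩ = u := by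
  have hs : HasSum (fun k => ((Real.sqrt (μ k) : ℝ) : ℂ) • specProj A μ k (sqrtBounded B u)) u := by
    convert hB.hasSum_eigenProj u using 2 with k
    rw [hAB.specProj_eq hB, hB.eigenProj_sqrtBounded, smul_inv_smul₀ (hB.sqrt_mu_ne_zero k)]
  exact ⟨hs.summable, hs.tsum_eq⟩

theorem IsBoundedInverse.sqrtBounded_sqrtOp {A : H →ₗ.[ℂ] H} {B : H →L[ℂ] H} {μ : ℕ → ℝ}
    (hAB : IsBoundedInverse A B) (hB : IsInverseOfDiscrete B μ) (f : formDomain A μ) :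
    sqrtBounded B (sqrtOp A μ f) = f := by
  have hs : HasSum (fun k => ((Real.sqrt (μ k) : ℝ) : ℂ) • specProj A μ k (f : H))
      (sqrtOp A μ f) := Summable.hasSum f.2
  refine ((sqrtBounded B).hasSum hs).unique ?_
  convert hB.hasSum_eigenProj (f : H) using 2 with k
  rw [hAB.specProj_eq hB, map_smul, hB.sqrtBounded_eigenProj,
    smul_inv_smul₀ (hB.sqrt_mu_ne_zero k)]

end LocalFormSub

/-! ### From the form to a bounded operator. -/

namespace LocalFormSub

open Set

variable {H : Type*} [NormedAddCommGroup H] [InnerProductSpace ℂ H] [CompleteSpace H]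

/-- The operator `K` satisfies `|⟨K u, w⟩| ≤ (∑ a_j ‖P_j u‖) (∑ a_j ‖P_j w‖)` with
`a_j = |ω_j| μ_j^{-1/2}`. -/
def IsLocallyBounded (B : H →L[ℂ] H) (μ ω : ℕ → ℝ) (K : H →L[ℂ] H) : Prop :=
  ∀ (u w : H) (α β : ℝ),
    (∀ n, ∑ j ∈ Finset.range n, |ω j| / Real.sqrt (μ j) * ‖eigenProj B μ j u‖ ≤ α) →
    (∀ n, ∑ j ∈ Finset.range n, |ω j| / Real.sqrt (μ j) * ‖eigenProj B μ j w‖ ≤ β) →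
    ‖inner ℂ w (K u)‖ ≤ α * β

section Form

variable {A : H →ₗ.[ℂ] H} {B : H →L[ℂ] H} {μ ω : ℕ → ℝ}

/-- The operator `A^{-1/2}` as a map onto the form domain of `A`. -/
def formLift (hAB : IsBoundedInverse A B) (hB : IsInverseOfDiscrete B μ) :
    H →ₗ[ℂ] formDomain A μ :=
  (sqrtBounded B : H →ₗ[ℂ] H).codRestrict (formDomain A μ) fun u => (hAB.sqrtOp_spec hB u).1

variable (hAB : IsBoundedInverse A B) (hB : IsInverseOfDiscrete B μ)

theorem coe_formLift (u : H) : (formLift hAB hB u : H) = sqrtBounded B u := rfl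

theorem sqrtOp_formLift (u : H) : sqrtOp A μ (formLift hAB hB u) = u :=
  (hAB.sqrtOp_spec hB u).2

theorem formLift_sqrtOp (f : formDomain A μ) : formLift hAB hB (sqrtOp A μ f) = f :=
  Subtype.ext (hAB.sqrtBounded_sqrtOp hB f)

-- With `f = B^{1/2} u` and test vectors `B^{1/2} w`, the defining relation `t(f, g) = ⟨h, g⟩`
-- becomes `u + K u = B^{1/2} h`. Solving `(z - T) f = x` is therefore solving `(z B - 1 - K) u =
-- B^{1/2} x`.
include hAB hB in
theorem isResolventAt_formSum {v : SesqForm (formDomain A μ)} {K : H →L[ℂ] H}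
    (hK : ∀ f g, v f g = inner ℂ (sqrtOp A μ g) (K (sqrtOp A μ f))) {z : ℂ}
    (hz : IsUnit (pencil B K z)) :
    IsResolventAt (formSum A μ v) z (pencilResolvent B K z) := by
  have hgraph : ∀ p : H × H, p ∈ formGraph (formDomain A μ) (baseForm A μ + v) ↔
      ∃ u, p.1 = sqrtBounded B u ∧ u + K u = sqrtBounded B p.2 := by
    have key : ∀ (f : formDomain A μ) (h : H),
        (∀ g, (baseForm A μ + v) f g = inner ℂ (g : H) h) ↔
          sqrtOp A μ f + K (sqrtOp A μ f) = sqrtBounded B h := by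
      intro f h
      have e : ∀ g, (baseForm A μ + v) f g
          = inner ℂ (sqrtOp A μ g) (sqrtOp A μ f + K (sqrtOp A μ f)) := fun g => by
        rw [inner_add_right, ← hK]
        rfl
      have e' : ∀ g : formDomain A μ, inner ℂ (g : H) h
          = inner ℂ (sqrtOp A μ g) (sqrtBounded B h) := fun g => by
        rw [← inner_sqrtBounded, hAB.sqrtBounded_sqrtOp hB]
      simp only [e, e']
      refine ⟨fun hg => ext_inner_left ℂ fun w => ?_, fun hg g => by rw [hg]⟩
      have := hg (formLift hAB hB w)
      rwa [sqrtOp_formLift] at this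
    rintro ⟨x, h⟩
    constructor
    · rintro ⟨f, hf, hf'⟩
      exact ⟨sqrtOp A μ f, by rw [hAB.sqrtBounded_sqrtOp hB, hf], (key f h).1 hf'⟩
    · rintro ⟨u, hu, hu'⟩
      refine ⟨formLift hAB hB u, hu.symm, (key _ h).2 ?_⟩
      rwa [sqrtOp_formLift]
  -- Single-valuedness of the graph, without which `toLinearPMap` would not have this graph; it
  -- rests on injectivity of `B^{1/2}`.
  have hfun : ∀ p : H × H, p ∈ formGraph (formDomain A μ) (baseForm A μ + v) →
      p.1 = 0 → p.2 = 0 := by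
    intro p hp h0
    obtain ⟨u, hu, hu'⟩ := (hgraph p).1 hp
    have h1 : u = 0 := hB.sqrtBounded_injective (by rw [← hu, h0])
    rw [h1, map_zero, add_zero] at hu'
    exact hB.sqrtBounded_injective hu'.symm
  have hmem : ∀ y : (formSum A μ v).domain, ∃ u, (y : H) = sqrtBounded B u ∧
      u + K u = sqrtBounded B (formSum A μ v y) := fun y =>
    (hgraph (y, formSum A μ v y)).1 (Submodule.mem_graph_toLinearPMap hfun y)
  have hp : ∀ u, pencil B K z u = z • sqrtBounded B (sqrtBounded B u) - (u + K u) := fun u => by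
    rw [← mul_apply_eq_comp (sqrtBounded B), hB.sqrtBounded_mul_self, pencil, sub_apply,
      sub_apply, smul_apply, one_apply_eq_self, sub_sub]
  refine ⟨fun x => ?_, fun y => ?_⟩
  · set u := Ring.inverse (pencil B K z) (sqrtBounded B x) with hu
    have hLu : pencil B K z u = sqrtBounded B x := by
      rw [hu, ← mul_apply_eq_comp, Ring.mul_inverse_cancel _ hz, one_apply_eq_self]
    have hin : (sqrtBounded B u, z • sqrtBounded B u - x)
        ∈ formGraph (formDomain A μ) (baseForm A μ + v) := by
      refine (hgraph _).2 ⟨u, rfl, ?_⟩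
      rw [map_sub, map_smul, ← hLu, hp]
      abel
    have hin' : (sqrtBounded B u, z • sqrtBounded B u - x) ∈ (formSum A μ v).graph := by
      rwa [formSum, formOperator, Submodule.toLinearPMap_graph_eq _ hfun]
    obtain ⟨y, hy, hy'⟩ := (LinearPMap.mem_graph_iff _).1 hin'
    exact ⟨y, hy, by rw [hy', hy, sub_sub_cancel]⟩
  · obtain ⟨u, hu, hu'⟩ := hmem y
    have h1 : sqrtBounded B (z • (y : H) - formSum A μ v y) = pencil B K z u := by
      rw [map_sub, map_smul, ← hu', hu, hp]
    rw [pencilResolvent, mul_apply_eq_comp, mul_apply_eq_comp, h1,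
      ← mul_apply_eq_comp (Ring.inverse _), Ring.inverse_mul_cancel _ hz, one_apply_eq_self, hu]

theorem tendsto_sum_eigenProj_form {φ : H →+ ℂ} {C : ℝ} (hφ : ∀ x, ‖φ x‖ ≤ C * ‖x‖)
    {B : H →L[ℂ] H} (hB : IsInverseOfDiscrete B μ) (u : H) :
    Tendsto (fun n => ∑ j ∈ Finset.range n, φ (eigenProj B μ j u)) atTop (𝓝 (φ u)) := by
  have hc : Continuous φ := AddMonoidHomClass.continuous_of_bound φ C hφ
  have := (hc.tendsto u).comp (hB.hasSum_eigenProj u).tendsto_sum_nat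
  simpa only [Function.comp_def, map_sum] using this

/-- The bound is summed over finitely many eigenspaces in both arguments; then the second argument
is sent to its limit with the first a finite sum, and afterwards the first. Each limit uses
continuity in one variable only, so separate continuity suffices. -/
theorem norm_form_formLift_le {v : SesqForm (formDomain A μ)} (hvc : SeparatelyContinuous A μ v)
    (hv : LocallySubordinated A μ ω v) {u w : H} {α β : ℝ}
    (hα : ∀ n, ∑ j ∈ Finset.range n, |ω j| / Real.sqrt (μ j) * ‖eigenProj B μ j u‖ ≤ α)
    (hβ : ∀ n, ∑ j ∈ Finset.range n, |ω j| / Real.sqrt (μ j) * ‖eigenProj B μ j w‖ ≤ β) :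
    ‖v (formLift hAB hB u) (formLift hAB hB w)‖ ≤ α * β := by
  set G := formLift hAB hB with hG
  have hα0 : 0 ≤ α := by simpa using hα 0
  set a : ℕ → ℝ := fun j => |ω j| / Real.sqrt (μ j) with ha
  have ha0 : ∀ j, 0 ≤ a j := fun j => by positivity
  have hblock : ∀ j k, ‖v (G (eigenProj B μ j u)) (G (eigenProj B μ k w))‖
      ≤ (a j * ‖eigenProj B μ j u‖) * (a k * ‖eigenProj B μ k w‖) := by
    intro j k
    have hpr : ∀ i x, ((G (eigenProj B μ i x) : formDomain A μ) : H)
        = specProj A μ i (G x : H) := fun i x => by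
      rw [hG, coe_formLift, coe_formLift, hAB.specProj_eq hB, hB.eigenProj_sqrtBounded,
        hB.sqrtBounded_eigenProj]
    have hnorm : ∀ i x, ‖specProj A μ i (G x : H)‖
        = (Real.sqrt (μ i))⁻¹ * ‖eigenProj B μ i x‖ := fun i x => by
      rw [hG, coe_formLift, hAB.specProj_eq hB, hB.eigenProj_sqrtBounded, norm_smul, norm_inv,
        Complex.norm_real, Real.norm_of_nonneg (Real.sqrt_nonneg _)]
    refine (hv j k (G u) (G w) _ _ (hpr j u) (hpr k w)).trans ?_
    rw [hnorm, hnorm]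
    have h1 : ω j * ω k ≤ |ω j| * |ω k| := by
      rw [← abs_mul]
      exact le_abs_self _
    calc ω j * ω k * ((Real.sqrt (μ j))⁻¹ * ‖eigenProj B μ j u‖)
          * ((Real.sqrt (μ k))⁻¹ * ‖eigenProj B μ k w‖)
        ≤ |ω j| * |ω k| * ((Real.sqrt (μ j))⁻¹ * ‖eigenProj B μ j u‖)
          * ((Real.sqrt (μ k))⁻¹ * ‖eigenProj B μ k w‖) := by gcongr
      _ = _ := by
        rw [ha]
        ring
  have hfin : ∀ m n, ‖∑ j ∈ Finset.range m, ∑ k ∈ Finset.range n,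
      v (G (eigenProj B μ j u)) (G (eigenProj B μ k w))‖ ≤ α * β := by
    intro m n
    calc _ ≤ ∑ j ∈ Finset.range m, ∑ k ∈ Finset.range n,
          (a j * ‖eigenProj B μ j u‖) * (a k * ‖eigenProj B μ k w‖) :=
          norm_sum_le_of_le _ fun j _ => norm_sum_le_of_le _ fun k _ => hblock j k
      _ = (∑ j ∈ Finset.range m, a j * ‖eigenProj B μ j u‖)
          * ∑ k ∈ Finset.range n, a k * ‖eigenProj B μ k w‖ := by
          rw [Finset.sum_mul_sum]
      _ ≤ α * β := mul_le_mul (hα m) (hβ n)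
          (Finset.sum_nonneg fun k _ => mul_nonneg (ha0 k) (norm_nonneg _)) hα0
  have hmid : ∀ m, ‖∑ j ∈ Finset.range m, v (G (eigenProj B μ j u)) (G w)‖ ≤ α * β := by
    intro m
    have ht : Tendsto (fun n => ∑ j ∈ Finset.range m, ∑ k ∈ Finset.range n,
        v (G (eigenProj B μ j u)) (G (eigenProj B μ k w))) atTop
        (𝓝 (∑ j ∈ Finset.range m, v (G (eigenProj B μ j u)) (G w))) := by
      refine tendsto_finsetSum _ fun j _ => ?_
      obtain ⟨C, hC⟩ := hvc.1 (G (eigenProj B μ j u))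
      refine tendsto_sum_eigenProj_form (C := C)
        (φ := (v (G (eigenProj B μ j u))).toAddMonoidHom.comp G.toAddMonoidHom) (fun x => ?_) hB w
      have := hC (G x)
      rwa [hG, sqrtOp_formLift, ← hG] at this
    exact le_of_tendsto' ht.norm fun n => hfin m n
  obtain ⟨C, hC⟩ := hvc.2 (G w)
  have ht := tendsto_sum_eigenProj_form (C := C)
    (φ := (v.flip (G w)).toAddMonoidHom.comp G.toAddMonoidHom) (fun x => by
      have := hC (G x)
      rwa [hG, sqrtOp_formLift, ← hG] at this) hB u
  exact le_of_tendsto' ht.norm hmid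

theorem IsInverseOfDiscrete.sum_mul_norm_eigenProj_le {B : H →L[ℂ] H}
    (hB : IsInverseOfDiscrete B μ) {a : ℕ → ℝ} {q : ℝ} {n : ℕ}
    (hq : ∑ j ∈ Finset.range n, a j ^ 2 ≤ q) (x : H) :
    ∑ j ∈ Finset.range n, a j * ‖eigenProj B μ j x‖ ≤ Real.sqrt q * ‖x‖ := by
  refine (Real.sum_mul_le_sqrt_mul_sqrt _ _ _).trans ?_
  refine mul_le_mul (Real.sqrt_le_sqrt hq) ?_ (Real.sqrt_nonneg _) (Real.sqrt_nonneg _)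
  exact Real.sqrt_le_iff.2 ⟨norm_nonneg _, hB.sum_norm_eigenProj_sq_le _ _⟩

-- By Cauchy-Schwarz and Bessel the transported form is bounded by `q = ∑ ω_j² / μ_j`, and Riesz
-- representation yields `K`. The finer blockwise estimate is kept as well, since it survives
-- compression by functions of `B`.
include hAB hB in
theorem exists_operator_of_form {v : SesqForm (formDomain A μ)}
    (hvc : SeparatelyContinuous A μ v) (hv : LocallySubordinated A μ ω v)
    (hω : Summable fun j => ω j ^ 2 / μ j) :
    ∃ K : H →L[ℂ] H, (∀ f g, v f g = inner ℂ (sqrtOp A μ g) (K (sqrtOp A μ f))) ∧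
      IsLocallyBounded B μ ω K := by
  set G := formLift hAB hB with hG
  set q := ∑' j, ω j ^ 2 / μ j with hq
  have hq0 : 0 ≤ q := tsum_nonneg fun j => div_nonneg (sq_nonneg _) (hB.mu_pos j).le
  have hsum : ∀ x n, ∑ j ∈ Finset.range n, |ω j| / Real.sqrt (μ j) * ‖eigenProj B μ j x‖
      ≤ Real.sqrt q * ‖x‖ := fun x n => by
    refine hB.sum_mul_norm_eigenProj_le ?_ x
    refine le_of_eq_of_le (Finset.sum_congr rfl fun j _ => ?_)
      (hω.sum_le_tsum (Finset.range n) fun j _ => div_nonneg (sq_nonneg _) (hB.mu_pos j).le)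
    rw [div_pow, sq_abs, Real.sq_sqrt (hB.mu_pos j).le]
  have hbound : ∀ w u, ‖v (G u) (G w)‖ ≤ q * ‖w‖ * ‖u‖ := fun w u => by
    refine (norm_form_formLift_le hAB hB hvc hv (hsum u) (hsum w)).trans_eq ?_
    rw [mul_mul_mul_comm, Real.mul_self_sqrt hq0]
    ring
  let b : H →ₗ⋆[ℂ] H →ₗ[ℂ] ℂ := LinearMap.mk₂'ₛₗ (starRingEnd ℂ) (RingHom.id ℂ)
    (fun w u => v (G u) (G w))
    (fun w w' u => by rw [map_add, map_add])
    (fun c w u => by rw [map_smul, LinearMap.map_smulₛₗ])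
    (fun w u u' => by rw [map_add, map_add, LinearMap.add_apply])
    (fun c w u => by rw [map_smul, map_smul, LinearMap.smul_apply]; rfl)
  let b' : H →L⋆[ℂ] H →L[ℂ] ℂ := b.mkContinuous₂ q hbound
  -- Riesz representation puts its operator on `w`, the conjugate-linear slot; the adjoint moves it
  -- to `u`.
  let K := ContinuousLinearMap.adjoint (InnerProductSpace.continuousLinearMapOfBilin b')
  have hK : ∀ u w, v (G u) (G w) = inner ℂ w (K u) := fun u w => by
    rw [ContinuousLinearMap.adjoint_inner_right,
      InnerProductSpace.continuousLinearMapOfBilin_apply]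
    rfl
  refine ⟨K, fun f g => ?_, fun u w α β hα hβ => ?_⟩
  · rw [← hK, hG, formLift_sqrtOp, formLift_sqrtOp]
  · rw [← hK]
    exact norm_form_formLift_le hAB hB hvc hv hα hβ

end Form

/-! ### Invertibility of the pencil. -/

theorem opNorm_le_of_norm_inner_le {H : Type*} [NormedAddCommGroup H] [InnerProductSpace ℂ H]
    {X : H →L[ℂ] H} {q : ℝ} (hq : 0 ≤ q)
    (h : ∀ u w, ‖inner ℂ w (X u)‖ ≤ q * ‖u‖ * ‖w‖) : ‖X‖ ≤ q := by
  refine X.opNorm_le_bound hq fun u => ?_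
  have h1 := h u (X u)
  rw [inner_self_eq_norm_sq_to_K, norm_pow, RCLike.norm_ofReal, abs_norm, sq] at h1
  rcases (norm_nonneg (X u)).eq_or_lt with h0 | h0
  · rw [← h0]
    positivity
  · exact le_of_mul_le_mul_right h1 h0

theorem IsInverseOfDiscrete.isUnit_pencil {B K : H →L[ℂ] H} {μ ω : ℕ → ℝ}
    (hB : IsInverseOfDiscrete B μ) (hK : IsLocallyBounded B μ ω K) {z : ℂ} (hz : ∀ j, z ≠ μ j)
    {q : ℝ} (hq : q < 1) (hω : ∀ n, ∑ j ∈ Finset.range n, ω j ^ 2 / ‖z - μ j‖ ≤ q)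
    {s : ℝ} (hs : s ∈ Icc (0 : ℝ) 1) : IsUnit (pencil B ((s : ℂ) • K) z) := by
  have := hB.isSelfAdjoint
  have hq0 : 0 ≤ q := by simpa using hω 0
  have hne : ∀ x ∈ _root_.spectrum ℂ B, z * x - 1 ≠ 0 := by
    intro x hx h
    rcases hB.spectrum_subset x hx with rfl | ⟨j, rfl⟩
    · simp at h
    · have hmu : (μ j : ℂ) ≠ 0 := Complex.ofReal_ne_zero.2 (hB.mu_pos j).ne'
      rw [sub_eq_zero, mul_inv_eq_one₀ hmu] at h
      exact hz j h
  have hnorm : ∀ x ∈ _root_.spectrum ℂ B, (‖z * x - 1‖ : ℂ) ≠ 0 := fun x hx =>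
    Complex.ofReal_ne_zero.2 (norm_ne_zero_iff.2 (hne x hx))
  have hsqrt : ∀ x ∈ _root_.spectrum ℂ B, ((Real.sqrt ‖z * x - 1‖ : ℝ) : ℂ) ≠ 0 := fun x hx =>
    Complex.ofReal_ne_zero.2 (Real.sqrt_pos.2 (norm_pos_iff.2 (hne x hx))).ne'
  -- Polar decomposition of `z x - 1` on the spectrum: `f` is the root of the modulus, `g` its
  -- inverse, `p` the phase and `p'` the inverse phase.
  let f : ℂ → ℂ := fun x => ((Real.sqrt ‖z * x - 1‖ : ℝ) : ℂ)
  let g : ℂ → ℂ := fun x => (((Real.sqrt ‖z * x - 1‖)⁻¹ : ℝ) : ℂ)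
  let p : ℂ → ℂ := fun x => (z * x - 1) / (‖z * x - 1‖ : ℂ)
  let p' : ℂ → ℂ := fun x => (‖z * x - 1‖ : ℂ) / (z * x - 1)
  have hf : ContinuousOn f (_root_.spectrum ℂ B) := by fun_prop
  have hg : ContinuousOn g (_root_.spectrum ℂ B) :=
    (hf.inv₀ hsqrt).congr fun x _ => Complex.ofReal_inv _
  have hp : ContinuousOn p (_root_.spectrum ℂ B) :=
    ContinuousOn.div (by fun_prop) (by fun_prop) hnorm
  have hp' : ContinuousOn p' (_root_.spectrum ℂ B) :=
    ContinuousOn.div (by fun_prop) (by fun_prop) hne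
  have hfg : cfc f B * cfc g B = 1 := by
    rw [← cfc_mul f g B hf hg, ← cfc_one ℂ B]
    refine cfc_congr fun x hx => ?_
    simp only [f, g, Complex.ofReal_inv]
    exact mul_inv_cancel₀ (hsqrt x hx)
  have hgf : cfc g B * cfc f B = 1 := by rw [(cfc_commute_cfc g f B).eq, hfg]
  have hpp' : cfc p B * cfc p' B = 1 := by
    rw [← cfc_mul p p' B hp hp', ← cfc_one ℂ B]
    refine cfc_congr fun x hx => ?_
    simp only [p, p']
    rw [div_mul_div_cancel₀ (hnorm x hx), div_self (hne x hx)]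
    rfl
  have hpp : cfc p' B * cfc p B = 1 := by rw [(cfc_commute_cfc p' p B).eq, hpp']
  have hfpf : cfc f B * cfc p B * cfc f B = z • B - 1 := by
    rw [← cfc_mul f p B hf hp, ← cfc_mul (fun x => f x * p x) f B (hf.mul hp) hf]
    calc _ = cfc (fun x => z * x - 1) B := by
          refine cfc_congr fun x hx => ?_
          simp only [f, p]
          rw [mul_right_comm, ← Complex.ofReal_mul, Real.mul_self_sqrt (norm_nonneg _),
            mul_div_cancel₀ _ (hnorm x hx)]
      _ = _ := by
          rw [cfc_sub (fun x => z * x) (fun _ => 1) B (by fun_prop) (by fun_prop),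
            cfc_const_mul z (fun x => x) B (by fun_prop), cfc_id' ℂ B, cfc_const_one ℂ B]
  have hp'norm : ‖cfc p' B‖ ≤ 1 := by
    refine norm_cfc_le zero_le_one fun x hx => ?_
    simp only [p']
    rw [norm_div, Complex.norm_real, norm_norm, div_self (norm_ne_zero_iff.2 (hne x hx))]
  have hgsa : ∀ u w, inner ℂ w (cfc g B u) = inner ℂ (cfc g B w) u := fun u w => by
    have h := ContinuousLinearMap.isSelfAdjoint_iff'.1
      (isSelfAdjoint_cfc (f := g) (B := B) fun _ => Complex.conj_ofReal _)
    conv_rhs => rw [← h]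
    rw [ContinuousLinearMap.adjoint_inner_left]
  -- On the `j`-th eigenspace `g` is `(|z - μ_j| / μ_j)^{-1/2}`. The factors `μ_j` cancel, leaving
  -- the coefficients `|ω_j| / |z - μ_j|^{1/2}`, whose squares sum to at most `q`.
  have hsum : ∀ u n, ∑ j ∈ Finset.range n,
      |ω j| / Real.sqrt (μ j) * ‖eigenProj B μ j (cfc g B u)‖ ≤ Real.sqrt q * ‖u‖ := by
    intro u n
    have hg' : ∀ j, ‖eigenProj B μ j (cfc g B u)‖
        = (Real.sqrt ‖z * (μ j : ℂ)⁻¹ - 1‖)⁻¹ * ‖eigenProj B μ j u‖ := fun j => by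
      rw [← mul_apply_eq_comp, hB.eigenProj_mul_cfc hg, smul_apply, norm_smul, Complex.norm_real,
        Real.norm_of_nonneg (by positivity)]
    simp only [hg', ← mul_assoc]
    refine hB.sum_mul_norm_eigenProj_le (le_of_eq_of_le (Finset.sum_congr rfl fun j _ => ?_) (hω n)) u
    have hmu := hB.mu_pos j
    have hmu' : (μ j : ℂ) ≠ 0 := Complex.ofReal_ne_zero.2 hmu.ne'
    have e : ‖z * (μ j : ℂ)⁻¹ - 1‖ = ‖z - μ j‖ / μ j := by
      rw [show z * (μ j : ℂ)⁻¹ - 1 = (z - μ j) / μ j by field_simp, norm_div, Complex.norm_real,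
        Real.norm_of_nonneg hmu.le]
    rw [mul_pow, div_pow, inv_pow, sq_abs, Real.sq_sqrt hmu.le, Real.sq_sqrt (norm_nonneg _), e,
      inv_div, div_mul_div_cancel₀ hmu.ne']
  have hX : ‖cfc g B * K * cfc g B‖ ≤ q := by
    refine opNorm_le_of_norm_inner_le hq0 fun u w => ?_
    rw [mul_apply_eq_comp, mul_apply_eq_comp, hgsa]
    refine (hK _ _ _ _ (hsum u) (hsum w)).trans_eq ?_
    rw [mul_mul_mul_comm, Real.mul_self_sqrt hq0, mul_assoc]
  have hsmall : ‖cfc p' B * ((s : ℂ) • (cfc g B * K * cfc g B))‖ < 1 := by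
    refine (norm_mul_le _ _).trans_lt ?_
    rw [norm_smul, Complex.norm_real, Real.norm_of_nonneg hs.1]
    calc ‖cfc p' B‖ * (s * ‖cfc g B * K * cfc g B‖) ≤ 1 * (1 * q) :=
          mul_le_mul hp'norm (mul_le_mul hs.2 hX (norm_nonneg _) zero_le_one)
            (mul_nonneg hs.1 (norm_nonneg _)) zero_le_one
      _ < 1 := by linarith
  have hfac : pencil B ((s : ℂ) • K) z = cfc f B * cfc p B *
      (1 - cfc p' B * ((s : ℂ) • (cfc g B * K * cfc g B))) * cfc f B := by
    have h1 : cfc f B * cfc p B * (cfc p' B * (cfc g B * K * cfc g B)) * cfc f B = K := by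
      calc _ = cfc f B * (cfc p B * cfc p' B) * cfc g B * K * (cfc g B * cfc f B) := by
            simp only [mul_assoc]
        _ = _ := by rw [hpp', hgf, mul_one, mul_one, hfg, one_mul]
    rw [mul_sub, sub_mul, mul_one, hfpf, mul_smul_comm, mul_smul_comm, smul_mul_assoc, h1, pencil]
  rw [hfac]
  have uf : IsUnit (cfc f B) := isUnit_iff_exists.2 ⟨_, hfg, hgf⟩
  have up : IsUnit (cfc p B) := isUnit_iff_exists.2 ⟨_, hpp', hpp⟩
  exact ((uf.mul up).mul (isUnit_one_sub_of_norm_lt_one hsmall)).mul uf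

end LocalFormSub

/-! ### Where the smallness condition holds. -/

namespace LocalFormSub

open Set

/-- The point `z` is not one of the `μ j` and `∑ ω_j² / |z - μ_j| < 1`. -/
def IsAdmissible (μ ω : ℕ → ℝ) (z : ℂ) : Prop :=
  (∀ j, z ≠ μ j) ∧ ∃ q < 1, ∀ n, ∑ j ∈ Finset.range n, ω j ^ 2 / ‖z - μ j‖ ≤ q

variable {μ ω : ℕ → ℝ}

/-- Replacing `|z - μ_j|` by its counterpart at `n` costs a factor `2`, hence the threshold `1 / 2`.
-/
theorem isAdmissible_of_near (hμ : StrictMono μ) {n : ℕ} {z : ℂ}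
    (hs : Summable fun j => if j = n then 0 else ω j ^ 2 / |μ n - μ j|)
    (hω : (∑' j, if j = n then 0 else ω j ^ 2 / |μ n - μ j|) + ω n ^ 2 / radius μ n < 1 / 2)
    (hz : ∀ j ≠ n, |μ n - μ j| ≤ 2 * ‖z - μ j‖) (hzn : radius μ n ≤ 2 * ‖z - μ n‖) :
    IsAdmissible μ ω z := by
  have hr := radius_pos hμ n
  have hgap : ∀ j ≠ n, 0 < |μ n - μ j| := fun j hj => by
    linarith [two_mul_radius_le hμ hj]
  have hpos : ∀ j, 0 < ‖z - μ j‖ := fun j => by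
    rcases eq_or_ne j n with rfl | hj
    · linarith
    · linarith [hgap j hj, hz j hj]
  refine ⟨fun j h => (hpos j).ne' (by rw [h, sub_self, norm_zero]), _,
    show 2 * ((∑' j, if j = n then 0 else ω j ^ 2 / |μ n - μ j|) + ω n ^ 2 / radius μ n) < 1 by
      linarith, fun m => ?_⟩
  have hterm : ∀ j, ω j ^ 2 / ‖z - μ j‖ ≤ 2 * ((if j = n then 0 else ω j ^ 2 / |μ n - μ j|)
      + if j = n then ω n ^ 2 / radius μ n else 0) := by
    intro j
    have aux : ∀ {a b : ℝ}, 0 < a → a ≤ 2 * b → ω j ^ 2 / b ≤ 2 * (ω j ^ 2 / a) := by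
      intro a b ha hab
      rw [← mul_div_assoc, div_le_div_iff₀ (by linarith) ha]
      nlinarith [sq_nonneg (ω j)]
    split_ifs with hj
    · subst hj
      rw [zero_add]
      exact aux hr hzn
    · rw [add_zero]
      exact aux (hgap j hj) (hz j hj)
  calc ∑ j ∈ Finset.range m, ω j ^ 2 / ‖z - μ j‖
      ≤ ∑ j ∈ Finset.range m, 2 * ((if j = n then 0 else ω j ^ 2 / |μ n - μ j|)
        + if j = n then ω n ^ 2 / radius μ n else 0) := Finset.sum_le_sum fun j _ => hterm j
    _ = 2 * (∑ j ∈ Finset.range m, (if j = n then 0 else ω j ^ 2 / |μ n - μ j|)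
        + ∑ j ∈ Finset.range m, if j = n then ω n ^ 2 / radius μ n else 0) := by
        rw [← Finset.mul_sum, Finset.sum_add_distrib]
    _ ≤ _ := by
        gcongr
        · refine hs.sum_le_tsum _ fun j _ => ?_
          split_ifs <;> positivity
        · rw [Finset.sum_ite_eq']
          split_ifs
          · exact le_rfl
          · positivity

/-- Finitely many terms are made small by the distance `h`, contributing at most `1 / 4`; the tail
is twice a tail of `∑ ω_j² / μ_j`, again at most `1 / 4`. -/
theorem isAdmissible_of_far (h0 : 0 < μ 0) (hμ : StrictMono μ) {J : ℕ} {h : ℝ} (hh : 0 < h) {z : ℂ}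
    (hlow : (∑ j ∈ Finset.range J, ω j ^ 2) / h ≤ 1 / 4)
    (hhigh : ∀ t : Finset ℕ, Disjoint t (Finset.range J) → ∑ j ∈ t, ω j ^ 2 / μ j ≤ 1 / 8)
    (hz : ∀ j < J, h ≤ ‖z - μ j‖) (hz' : ∀ j ≥ J, μ j ≤ 2 * ‖z - μ j‖) :
    IsAdmissible μ ω z := by
  have hmu : ∀ j, 0 < μ j := fun j => h0.trans_le (hμ.monotone j.zero_le)
  have hpos : ∀ j, 0 < ‖z - μ j‖ := fun j => by
    rcases lt_or_ge j J with hj | hj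
    · exact hh.trans_le (hz j hj)
    · linarith [hz' j hj, hmu j]
  refine ⟨fun j h => (hpos j).ne' (by rw [h, sub_self, norm_zero]), 1 / 2, by norm_num,
    fun n => ?_⟩
  rw [← Finset.sum_filter_add_sum_filter_not (Finset.range n) (· < J)]
  have h1 : ∑ j ∈ Finset.range n with j < J, ω j ^ 2 / ‖z - μ j‖ ≤ 1 / 4 := by
    refine le_trans ?_ hlow
    rw [Finset.sum_div]
    calc _ ≤ ∑ j ∈ Finset.range n with j < J, ω j ^ 2 / h := Finset.sum_le_sum fun j hj => by
          have := hz j (Finset.mem_filter.1 hj).2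
          gcongr
      _ ≤ _ := Finset.sum_le_sum_of_subset_of_nonneg
          (fun j hj => Finset.mem_range.2 (Finset.mem_filter.1 hj).2) fun _ _ _ => by positivity
  have h2 : ∑ j ∈ Finset.range n with ¬j < J, ω j ^ 2 / ‖z - μ j‖ ≤ 2 * (1 / 8) := by
    refine le_trans ?_ (mul_le_mul_of_nonneg_left
      (hhigh ((Finset.range n).filter fun j => ¬j < J) ?_) two_pos.le)
    · rw [Finset.mul_sum]
      refine Finset.sum_le_sum fun j hj => ?_
      have := hz' j (not_lt.1 (Finset.mem_filter.1 hj).2)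
      rw [← mul_div_assoc, div_le_div_iff₀ (hpos j) (hmu j)]
      nlinarith [sq_nonneg (ω j)]
    · refine Finset.disjoint_left.2 fun j hj hj' => ?_
      exact (Finset.mem_filter.1 hj).2 (Finset.mem_range.1 hj')
  linarith

theorem abs_re_sub_le (z : ℂ) (x : ℝ) : |z.re - x| ≤ ‖z - x‖ := by
  simpa using Complex.abs_re_le_norm (z - x)

theorem abs_im_le_norm_sub (z : ℂ) (x : ℝ) : |z.im| ≤ ‖z - x‖ := by
  simpa using Complex.abs_im_le_norm (z - x)

theorem exists_forall_abs_sub_le (hμ : Tendsto μ atTop atTop) (x : ℝ) :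
    ∃ n, ∀ j, |x - μ n| ≤ |x - μ j| := by
  have h : Tendsto (fun j => |x - μ j|) cofinite atTop := by
    rw [Nat.cofinite_eq_atTop]
    refine tendsto_abs_atBot_atTop.comp ?_
    exact tendsto_atBot_add_const_left _ x (tendsto_neg_atTop_atBot.comp hμ)
  exact h.exists_forall_le

/-- The first two regions are far from the spectrum of `A`, the other three are compared with one `μ
n`, `n ≥ N`. The strip of width `r_N / 2` and the annuli `r_k / 2 ≤ |z - μ_k| ≤ r_k` provide room
for a second contour inside each boundary. -/
theorem exists_admissible (h0 : 0 < μ 0) (hμ : StrictMono μ) (hμt : Tendsto μ atTop atTop)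
    (hω : WeightCondition μ ω) :
    ∃ (N : ℕ) (h : ℝ), 0 < h ∧ (∀ z : ℂ, z.re ≤ -h → IsAdmissible μ ω z) ∧
      (∀ z : ℂ, h ≤ |z.im| → z.re ≤ μ N + radius μ N → IsAdmissible μ ω z) ∧
      (∀ z : ℂ, μ N + radius μ N / 2 ≤ z.re → z.re ≤ μ N + radius μ N → IsAdmissible μ ω z) ∧
      (∀ z : ℂ, μ N + radius μ N < z.re → (∀ k > N, z ∉ disk μ k) → IsAdmissible μ ω z) ∧
      ∀ k > N, ∀ z : ℂ, radius μ k / 2 ≤ ‖z - μ k‖ → ‖z - μ k‖ ≤ radius μ k →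
        IsAdmissible μ ω z := by
  obtain ⟨hs, hsn, hlim⟩ := hω
  obtain ⟨N, hN⟩ := eventually_atTop.1 (hlim.eventually_lt_const (show (0 : ℝ) < 1 / 2 by norm_num))
  have hmu : ∀ j, 0 < μ j := fun j => h0.trans_le (hμ.monotone j.zero_le)
  have hr := radius_pos hμ
  set b := μ N + radius μ N with hb
  have hb0 : 0 < b := add_pos (hmu N) (hr N)
  obtain ⟨s, hs'⟩ := summable_iff_vanishing_norm.1 hs (1 / 8) (by norm_num)
  obtain ⟨J₁, hJ₁⟩ := s.exists_nat_subset_range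
  -- If `Re z ≤ b` and `μ_j ≥ 2 b`, then `|z - μ_j| ≥ μ_j - b ≥ μ_j / 2`.
  obtain ⟨J₂, hJ₂⟩ := eventually_atTop.1 (hμt.eventually_ge_atTop (2 * b))
  set J := max J₁ J₂ with hJ
  set S := ∑ j ∈ Finset.range J, ω j ^ 2 with hS
  have hS0 : 0 ≤ S := Finset.sum_nonneg fun j _ => sq_nonneg _
  -- The height is `h = 4 S + 1`, so that `S / h ≤ 1 / 4`; the summand `1` keeps it positive when `S
  -- = 0`.
  have hh : 0 < 4 * S + 1 := by linarith
  have hlow : S / (4 * S + 1) ≤ 1 / 4 := by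
    rw [div_le_div_iff₀ hh (by norm_num)]
    linarith
  have hhigh : ∀ t : Finset ℕ, Disjoint t (Finset.range J) → ∑ j ∈ t, ω j ^ 2 / μ j ≤ 1 / 8 := by
    intro t ht
    refine (le_abs_self _).trans (hs' t (ht.mono_right ?_)).le
    exact hJ₁.trans (Finset.range_subset_range.2 (le_max_left _ _))
  have hbig : ∀ j ≥ J, 2 * b ≤ μ j := fun j hj => hJ₂ j ((le_max_right _ _).trans hj)
  refine ⟨N, 4 * S + 1, hh, fun z hz => ?_, fun z hz hz' => ?_, fun z hz hz' => ?_,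
    fun z hz hz' => ?_, fun k hk z hz hz' => ?_⟩
  · have h1 : ∀ j, μ j + (4 * S + 1) ≤ ‖z - μ j‖ := fun j => by
      have := abs_re_sub_le z (μ j)
      have := neg_le_abs (z.re - μ j)
      linarith
    refine isAdmissible_of_far h0 hμ hh hlow hhigh (fun j _ => ?_) fun j _ => ?_
    · linarith [h1 j, hmu j]
    · linarith [h1 j, hmu j]
  · refine isAdmissible_of_far h0 hμ hh hlow hhigh
      (fun j _ => hz.trans (abs_im_le_norm_sub z _)) fun j hj => ?_
    have := abs_re_sub_le z (μ j)
    have := neg_le_abs (z.re - μ j)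
    linarith [hbig j hj]
  · refine isAdmissible_of_near hμ (hsn N) (hN N le_rfl) (fun j hj => ?_) ?_
    · have h1 := abs_re_sub_le z (μ j)
      rcases lt_or_gt_of_ne hj with h | h
      · have h2 := hμ h
        rw [abs_of_pos (by linarith)]
        linarith [le_abs_self (z.re - μ j), hr N]
      · have h2 := hμ h
        have h3 := two_mul_radius_le hμ hj
        rw [abs_of_neg (by linarith)] at h3 ⊢
        linarith [neg_le_abs (z.re - μ j)]
    · have h1 := abs_re_sub_le z (μ N)
      linarith [le_abs_self (z.re - μ N)]
  -- For the `μ n` nearest to `Re z`, the triangle inequality gives `|μ_n - μ_j| ≤ 2 |Re z - μ_j|`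
  -- for every `j`.
  · obtain ⟨n, hn⟩ := exists_forall_abs_sub_le hμt z.re
    have hnN : N ≤ n := by
      by_contra! h
      have h1 := hn N
      have h2 := hμ h
      rw [abs_of_pos (by linarith [hr N]), abs_of_pos (by linarith [hr N])] at h1
      linarith
    refine isAdmissible_of_near hμ (hsn n) (hN n hnN) (fun j _ => ?_) ?_
    · have h1 := abs_re_sub_le z (μ j)
      have h2 := hn j
      have h3 := abs_sub_le (μ n) z.re (μ j)
      rw [abs_sub_comm (μ n) z.re] at h3
      linarith
    · rcases hnN.eq_or_lt with rfl | h
      · have h1 := abs_re_sub_le z (μ N)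
        linarith [le_abs_self (z.re - μ N), hr N]
      · have h1 := hz' n h
        rw [disk, Metric.mem_ball, not_lt, dist_eq_norm] at h1
        linarith [hr n]
  · refine isAdmissible_of_near hμ (hsn k) (hN k hk.le) (fun j hj => ?_) (by linarith)
    have h1 := two_mul_radius_le hμ hj
    have h2 : |μ k - μ j| ≤ ‖z - μ k‖ + ‖z - μ j‖ := by
      have := norm_sub_le (z - μ j) (z - μ k)
      rw [sub_sub_sub_cancel_left, ← Complex.ofReal_sub, Complex.norm_real, Real.norm_eq_abs] at this
      linarith
    linarith

end LocalFormSub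

/-! ### Riesz projections and their dependence on the coupling constant. -/

namespace LocalFormSub

open Set

section Contours

variable {𝔸 : Type*} [NormedRing 𝔸] [NormedAlgebra ℂ 𝔸] [CompleteSpace 𝔸]

/-- `(2πi)⁻¹ ∫ R(z) dz` along a contour. -/
def Contour.rieszProj {E : Type*} [NormedAddCommGroup E] [NormedSpace ℂ E] (c : Contour)
    (R : ℂ → E) : E :=
  (2 * Real.pi * Complex.I : ℂ)⁻¹ • c.integral R

/-- The projection is squared by multiplying two copies over nested contours: `d` lies inside `c`
and carries the same integral. -/
theorem Contour.isIdempotentElem_rieszProj {c d : Contour} {R : ℂ → 𝔸}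
    (hcd : Disjoint c.trace d.trace) (hc : ContinuousOn R c.trace) (hd : ContinuousOn R d.trace)
    (hR : ∀ z ∈ c.trace, ∀ w ∈ d.trace, R z - R w = (w - z) • (R z * R w))
    (hm : ∀ w ∈ d.trace, c.index w = 2 * Real.pi * Complex.I) (hn : ∀ z ∈ c.trace, d.index z = 0)
    (heq : c.integral R = d.integral R) : IsIdempotentElem (c.rieszProj R) := by
  have h := c.integral_mul_integral d hcd hc hd hR hm hn
  rw [← heq, zero_smul, zero_add] at h
  rw [IsIdempotentElem, rieszProj, smul_mul_smul_comm, h, smul_smul, mul_assoc,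
    inv_mul_cancel₀ Complex.two_pi_I_ne_zero, mul_one]

theorem Contour.rieszProj_mul_eq_zero {c d : Contour} {R : ℂ → 𝔸}
    (hcd : Disjoint c.trace d.trace) (hc : ContinuousOn R c.trace) (hd : ContinuousOn R d.trace)
    (hR : ∀ z ∈ c.trace, ∀ w ∈ d.trace, R z - R w = (w - z) • (R z * R w))
    (hm : ∀ w ∈ d.trace, c.index w = 0) (hn : ∀ z ∈ c.trace, d.index z = 0) :
    c.rieszProj R * d.rieszProj R = 0 := by
  have h := c.integral_mul_integral d hcd hc hd hR hm hn
  rw [rieszProj, rieszProj, smul_mul_smul_comm, h, zero_smul, zero_smul, add_zero, smul_zero]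

end Contours

variable {H : Type*} [NormedAddCommGroup H] [InnerProductSpace ℂ H] [CompleteSpace H]

/-- The inverse pencils at `s` and `t` differ by `(s - t)` times (inverse at `s`) `K` (inverse at
`t`), and the inverses are uniformly bounded on the compact set `[0, 1] × c.trace`. The integral is
therefore Lipschitz in `s`. -/
theorem continuousOn_rieszProj_pencilResolvent {B K : H →L[ℂ] H} (c : Contour)
    (hu : ∀ s ∈ Icc (0 : ℝ) 1, ∀ z ∈ c.trace, IsUnit (pencil B ((s : ℂ) • K) z)) :
    ContinuousOn (fun s : ℝ => c.rieszProj (pencilResolvent B ((s : ℂ) • K))) (Icc 0 1) := by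
  have hcont : ContinuousOn (fun p : ℝ × ℂ => Ring.inverse (pencil B ((p.1 : ℂ) • K) p.2))
      (Icc (0 : ℝ) 1 ×ˢ c.trace) := by
    intro p hp
    have h1 : ContinuousAt (fun p : ℝ × ℂ => pencil B ((p.1 : ℂ) • K) p.2) p := by
      unfold pencil
      fun_prop
    have h2 : ContinuousAt (Ring.inverse : (H →L[ℂ] H) → H →L[ℂ] H)
        (pencil B ((p.1 : ℂ) • K) p.2) := by
      have hp' := hu p.1 hp.1 p.2 hp.2
      rw [← hp'.unit_spec]
      exact NormedRing.inverse_continuousAt _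
    exact (ContinuousAt.comp (f := fun p : ℝ × ℂ => pencil B ((p.1 : ℂ) • K) p.2) h2
      h1).continuousWithinAt
  obtain ⟨M, hM⟩ := (isCompact_Icc.prod c.isCompact_trace).exists_bound_of_continuousOn hcont
  obtain ⟨C, hC0, hC⟩ := c.exists_norm_integral_le (E := H →L[ℂ] H)
  have hRc : ∀ s ∈ Icc (0 : ℝ) 1, ContinuousOn (pencilResolvent B ((s : ℂ) • K)) c.trace :=
    fun s hs z hz =>
      (differentiableAt_pencilResolvent (hu s hs z hz)).continuousAt.continuousWithinAt
  set G := sqrtBounded B with hG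
  set L := ‖G‖ * (M * ‖K‖ * M) * ‖G‖ with hL
  have hdiff : ∀ s ∈ Icc (0 : ℝ) 1, ∀ t ∈ Icc (0 : ℝ) 1, ∀ z ∈ c.trace,
      ‖pencilResolvent B ((s : ℂ) • K) z - pencilResolvent B ((t : ℂ) • K) z‖ ≤ L * |s - t| := by
    intro s hs t ht z hz
    have hQM := hM (s, z) ⟨hs, hz⟩
    have hSM := hM (t, z) ⟨ht, hz⟩
    simp only at hQM hSM
    simp only [pencilResolvent, ← hG]
    set Q := Ring.inverse (pencil B ((s : ℂ) • K) z)
    set S := Ring.inverse (pencil B ((t : ℂ) • K) z)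
    have h1 : Q * pencil B ((s : ℂ) • K) z = 1 := Ring.inverse_mul_cancel _ (hu s hs z hz)
    have h2 : pencil B ((t : ℂ) • K) z * S = 1 := Ring.mul_inverse_cancel _ (hu t ht z hz)
    have h3 : pencil B ((t : ℂ) • K) z - pencil B ((s : ℂ) • K) z = ((s - t : ℝ) : ℂ) • K := by
      rw [pencil, pencil, Complex.ofReal_sub, sub_smul]
      abel
    have h4 : Q - S = ((s - t : ℝ) : ℂ) • (Q * K * S) := by
      rw [← smul_mul_assoc, ← mul_smul_comm, ← h3, mul_sub, h1, sub_mul, one_mul, mul_assoc, h2,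
        mul_one]
    have h5 : G * Q * G - G * S * G = ((s - t : ℝ) : ℂ) • (G * (Q * K * S) * G) := by
      rw [← sub_mul, ← mul_sub, h4, mul_smul_comm, smul_mul_assoc]
    have hM0 : 0 ≤ M := (norm_nonneg _).trans hQM
    rw [h5, norm_smul, Complex.norm_real, Real.norm_eq_abs, mul_comm]
    gcongr
    calc ‖G * (Q * K * S) * G‖ ≤ ‖G‖ * (‖Q‖ * ‖K‖ * ‖S‖) * ‖G‖ := by
          refine (norm_mul_le _ _).trans ?_
          gcongr
          refine (norm_mul_le _ _).trans ?_
          gcongr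
          refine (norm_mul_le _ _).trans ?_
          gcongr
          exact norm_mul_le _ _
      _ ≤ L := by
          rw [hL]
          gcongr
  intro s hs
  rw [ContinuousWithinAt, tendsto_iff_norm_sub_tendsto_zero]
  have hlim : Tendsto (fun t : ℝ => ‖(2 * Real.pi * Complex.I : ℂ)⁻¹‖ * (C * (L * |t - s|)))
      (𝓝[Icc 0 1] s) (𝓝 0) := by
    have h : Continuous fun t : ℝ => ‖(2 * Real.pi * Complex.I : ℂ)⁻¹‖ * (C * (L * |t - s|)) := by
      fun_prop
    simpa using (h.tendsto s).mono_left nhdsWithin_le_nhds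
  refine squeeze_zero' (Eventually.of_forall fun _ => norm_nonneg _) ?_ hlim
  filter_upwards [self_mem_nhdsWithin] with t ht
  rw [Contour.rieszProj, Contour.rieszProj, ← smul_sub, norm_smul,
    ← c.integral_sub (hRc t ht) (hRc s hs)]
  exact mul_le_mul_of_nonneg_left (hC _ _ (hdiff t ht s hs)) (norm_nonneg _)

theorem frontier_box_subset {μ : ℕ → ℝ} {N : ℕ} {h₁ h₂ : ℝ} :
    frontier (box μ N h₁ h₂) ⊆ {z | z.re ≤ μ N + radius μ N ∧ |z.im| ≤ h₂ ∧
      (z.re = -h₁ ∨ z.re = μ N + radius μ N ∨ |z.im| = h₂)} := by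
  have hcl : closure (box μ N h₁ h₂)
      ⊆ {z | -h₁ ≤ z.re ∧ z.re ≤ μ N + radius μ N ∧ |z.im| ≤ h₂} := by
    refine closure_minimal (fun z hz => ⟨hz.1.le, hz.2.1, hz.2.2⟩) ?_
    exact (isClosed_le continuous_const Complex.continuous_re).inter
      ((isClosed_le Complex.continuous_re continuous_const).inter
        (isClosed_le Complex.continuous_im.abs continuous_const))
  have hint : {z : ℂ | -h₁ < z.re ∧ z.re < μ N + radius μ N ∧ |z.im| < h₂}
      ⊆ interior (box μ N h₁ h₂) := by
    refine interior_maximal (fun z hz => ⟨hz.1, hz.2.1.le, hz.2.2.le⟩) ?_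
    exact (isOpen_lt continuous_const Complex.continuous_re).inter
      ((isOpen_lt Complex.continuous_re continuous_const).inter
        (isOpen_lt Complex.continuous_im.abs continuous_const))
  rintro z ⟨hz, hz'⟩
  obtain ⟨a1, a2, a3⟩ := hcl hz
  refine ⟨a2, a3, ?_⟩
  by_contra! h
  exact hz' (hint ⟨lt_of_le_of_ne a1 (Ne.symm h.1), lt_of_le_of_ne a2 h.2.1,
    lt_of_le_of_ne a3 h.2.2⟩)

end LocalFormSub

end

/-! ### Assembly of the theorem. -/

open LocalFormSub in
theorem proposition2p2 {H : Type*} [NormedAddCommGroup H] [InnerProductSpace ℂ H]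
    [CompleteSpace H] [TopologicalSpace.SeparableSpace H]
    (A : H →ₗ.[ℂ] H) (hA : IsSelfAdjoint A)
    (μ : ℕ → ℝ) (hμ : HasSpectrumSeq A μ)
    (v : SesqForm (formDomain A μ)) (hvc : SeparatelyContinuous A μ v)
    (ω : ℕ → ℝ) (hv : LocallySubordinated A μ ω v) (hω : WeightCondition μ ω) :
    ∃ (N : ℕ) (h₁ h₂ : ℝ), 0 < h₁ ∧ 0 < h₂ ∧
      -- localization of the spectrum
      LocalFormSub.spectrum (formSum A μ v) ⊆ box μ N h₁ h₂ ∪ ⋃ k > N, disk μ k ∧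
      -- the contour integrals are well defined
      frontier (box μ N h₁ h₂) ⊆ LocalFormSub.resolventSet (formSum A μ v) ∧
      ContinuousOn (LocalFormSub.resolvent (formSum A μ v)) (frontier (box μ N h₁ h₂)) ∧
      (∀ k > N, frontier (disk μ k) ⊆ LocalFormSub.resolventSet (formSum A μ v) ∧
        ContinuousOn (LocalFormSub.resolvent (formSum A μ v)) (frontier (disk μ k))) ∧
      -- they are projections
      IsIdempotentElem (boxProj (formSum A μ v) μ N h₁ h₂) ∧
      (∀ k > N, IsIdempotentElem (diskProj (formSum A μ v) μ k)) ∧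
      -- they are disjoint
      (∀ k > N, boxProj (formSum A μ v) μ N h₁ h₂ * diskProj (formSum A μ v) μ k = 0 ∧
        diskProj (formSum A μ v) μ k * boxProj (formSum A μ v) μ N h₁ h₂ = 0) ∧
      (∀ j > N, ∀ k > N, j ≠ k →
        diskProj (formSum A μ v) μ j * diskProj (formSum A μ v) μ k = 0) ∧
      -- ranks, finite or infinite
      opRank (boxProj (formSum A μ v) μ N h₁ h₂)
        = opRank (∑ k ∈ Finset.range (N + 1), specProj A μ k) ∧
      (∀ k > N, opRank (diskProj (formSum A μ v) μ k) = opRank (specProj A μ k)) := by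
  obtain ⟨B, hAB⟩ := exists_isBoundedInverse hμ
  have hB := hAB.isInverseOfDiscrete hA hμ
  have hmono := hB.strictMono
  have hr := radius_pos hmono
  obtain ⟨K, hK, hKloc⟩ := exists_operator_of_form hAB hB hvc hv hω.1
  obtain ⟨N, h, hh, ad1, ad2, ad3, ad4, ad5⟩ :=
    exists_admissible hB.pos hmono hB.tendsto hω
  set b := μ N + radius μ N with hb
  have hb0 : 0 < b := add_pos (hB.mu_pos N) (hr N)
  -- geometry of the centres and radii
  have hgap : ∀ k > N, b < μ k - radius μ k / 2 := fun k hk => by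
    have h1 := two_mul_radius_le hmono (show N ≠ k from hk.ne)
    have h2 := two_mul_radius_le hmono (show k ≠ N from hk.ne')
    have h3 := hmono hk
    have h4 := hr N
    rw [abs_of_pos (by linarith)] at h1
    rw [abs_of_neg (by linarith)] at h2
    linarith
  have hunit : ∀ z, IsAdmissible μ ω z → ∀ s ∈ Set.Icc (0 : ℝ) 1,
      IsUnit (pencil B ((s : ℂ) • K) z) := fun z hz s hs => by
    obtain ⟨hz1, q, hq, hz2⟩ := hz
    exact hB.isUnit_pencil hKloc hz1 hq hz2 hs
  have hdiff : ∀ z, IsAdmissible μ ω z → ∀ s ∈ Set.Icc (0 : ℝ) 1,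
      DifferentiableAt ℂ (pencilResolvent B ((s : ℂ) • K)) z := fun z hz s hs =>
    differentiableAt_pencilResolvent (hunit z hz s hs)
  have hident : ∀ z w, IsAdmissible μ ω z → IsAdmissible μ ω w → ∀ s ∈ Set.Icc (0 : ℝ) 1,
      pencilResolvent B ((s : ℂ) • K) z - pencilResolvent B ((s : ℂ) • K) w = (w - z) •
        (pencilResolvent B ((s : ℂ) • K) z * pencilResolvent B ((s : ℂ) • K) w) :=
    fun z w hz hw s hs =>
      pencilResolvent_sub hB.sqrtBounded_mul_self (hunit z hz s hs) (hunit w hw s hs)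
  have h1mem : (1 : ℝ) ∈ Set.Icc (0 : ℝ) 1 := Set.right_mem_Icc.2 zero_le_one
  have hres : ∀ z, IsAdmissible μ ω z →
      IsResolventAt (formSum A μ v) z (pencilResolvent B (((1 : ℝ) : ℂ) • K) z) := fun z hz => by
    have := hunit z hz 1 h1mem
    rw [Complex.ofReal_one, one_smul] at this ⊢
    exact isResolventAt_formSum hAB hB hK this
  have hresC : ∀ S : Set ℂ, (∀ z ∈ S, IsAdmissible μ ω z) →
      S ⊆ resolventSet (formSum A μ v) ∧ ContinuousOn (resolvent (formSum A μ v)) S :=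
    fun S hS => ⟨fun z hz => ⟨_, hres z (hS z hz)⟩,
      ContinuousOn.congr
        (fun z hz => (hdiff z (hS z hz) 1 h1mem).continuousAt.continuousWithinAt)
        fun z hz => (hres z (hS z hz)).resolvent_eq⟩
  -- contours
  have hab : -(2 * h) ≤ b := by linarith
  have hcd : -(2 * h) ≤ 2 * h := by linarith
  set c0 := Contour.rect (-(2 * h)) b (-(2 * h)) (2 * h) hab hcd with hc0
  have hab' : -h ≤ μ N + radius μ N / 2 := by linarith [hB.mu_pos N, hr N]
  have hcd' : -h ≤ h := by linarith
  set c0' := Contour.rect (-h) (μ N + radius μ N / 2) (-h) h hab' hcd' with hc0'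
  set c : ℕ → Contour := fun k => Contour.circle (μ k) (radius μ k) with hc
  set c' : ℕ → Contour := fun k => Contour.circle (μ k) (radius μ k / 2) with hc'
  have adshell : ∀ z : ℂ, z.re ≤ b →
      ¬(z.re ∈ Set.Ioo (-h) (μ N + radius μ N / 2) ∧ z.im ∈ Set.Ioo (-h) h) →
      IsAdmissible μ ω z := by
    intro z hz hz'
    by_cases e1 : z.re ≤ -h
    · exact ad1 z e1
    by_cases e2 : μ N + radius μ N / 2 ≤ z.re
    · exact ad3 z e2 hz
    refine ad2 z ?_ hz
    by_contra! e3
    exact hz' ⟨⟨not_le.1 e1, not_le.1 e2⟩, abs_lt.1 e3⟩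
  have tr0 : ∀ z ∈ c0.trace, z.re ≤ b ∧
      (z.re = -(2 * h) ∨ z.re = b ∨ z.im = -(2 * h) ∨ z.im = 2 * h) := fun z hz => by
    obtain ⟨e1, -, e3⟩ := Contour.rect_trace _ _ _ _ hab hcd hz
    exact ⟨e1.2, e3⟩
  have tr0' : ∀ z ∈ c0'.trace, z.re ∈ Set.Icc (-h) (μ N + radius μ N / 2) ∧ z.im ∈ Set.Icc (-h) h ∧
      (z.re = -h ∨ z.re = μ N + radius μ N / 2 ∨ z.im = -h ∨ z.im = h) := fun z hz =>
    Contour.rect_trace _ _ _ _ hab' hcd' hz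
  have trk : ∀ k, ∀ z ∈ (c k).trace, ‖z - μ k‖ = radius μ k := fun k z hz =>
    mem_sphere_iff_norm.1 (Contour.circle_trace _ (hr k).le hz)
  have trk' : ∀ k, ∀ z ∈ (c' k).trace, ‖z - μ k‖ = radius μ k / 2 := fun k z hz =>
    mem_sphere_iff_norm.1 (Contour.circle_trace _ (half_pos (hr k)).le hz)
  have adc0 : ∀ z ∈ c0.trace, IsAdmissible μ ω z := fun z hz => by
    obtain ⟨e1, e2⟩ := tr0 z hz
    refine adshell z e1 fun e => ?_
    have := hr N
    grind
  have adc0' : ∀ z ∈ c0'.trace, IsAdmissible μ ω z := fun z hz => by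
    obtain ⟨e1, -, e2⟩ := tr0' z hz
    refine adshell z (by linarith [e1.2, hr N]) fun e => ?_
    grind
  have adck : ∀ k > N, ∀ z ∈ (c k).trace, IsAdmissible μ ω z := fun k hk z hz =>
    ad5 k hk z (by linarith [trk k z hz, hr k]) (trk k z hz).le
  have adck' : ∀ k > N, ∀ z ∈ (c' k).trace, IsAdmissible μ ω z := fun k hk z hz =>
    ad5 k hk z (trk' k z hz).ge (by linarith [trk' k z hz, hr k])
  have hcontR : ∀ e : Contour, (∀ z ∈ e.trace, IsAdmissible μ ω z) → ∀ s ∈ Set.Icc (0 : ℝ) 1,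
      ContinuousOn (pencilResolvent B ((s : ℂ) • K)) e.trace := fun e he s hs z hz =>
    (hdiff z (he z hz) s hs).continuousAt.continuousWithinAt
  -- the Riesz projections as contour integrals of the pencil resolvent
  have hbox : boxProj (formSum A μ v) μ N (2 * h) (2 * h)
      = c0.rieszProj (pencilResolvent B (((1 : ℝ) : ℂ) • K)) := by
    rw [boxProj, rectProj, ← Contour.rect_integral _ _ _ _ hab hcd, Contour.rieszProj,
      Contour.integral_congr c0 fun z hz => (hres z (adc0 z hz)).resolvent_eq.symm]
  have hdisk : ∀ k > N, diskProj (formSum A μ v) μ k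
      = (c k).rieszProj (pencilResolvent B (((1 : ℝ) : ℂ) • K)) := fun k hk => by
    rw [diskProj, circleProj, ← Contour.circle_integral, Contour.rieszProj,
      Contour.integral_congr (c k) fun z hz => (hres z (adck k hk z hz)).resolvent_eq.symm]
  have hmove0 : ∀ s ∈ Set.Icc (0 : ℝ) 1, c0.integral (pencilResolvent B ((s : ℂ) • K))
      = c0'.integral (pencilResolvent B ((s : ℂ) • K)) := fun s hs =>
    Contour.rect_integral_eq_of_shell (by linarith) hab' (by linarith [hr N]) (by linarith) hcd'
      (by linarith) fun z e1 _ e3 => hdiff z (adshell z e1.2 e3) s hs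
  have hmovek : ∀ k > N, ∀ s ∈ Set.Icc (0 : ℝ) 1,
      (c k).integral (pencilResolvent B ((s : ℂ) • K))
        = (c' k).integral (pencilResolvent B ((s : ℂ) • K)) := fun k hk s hs =>
    Contour.circle_integral_eq_of_annulus (half_pos (hr k)) (half_le_self (hr k).le)
      fun z hz => hdiff z (ad5 k hk z
        (by have := hz.2; rwa [mem_ball_iff_norm, not_lt] at this)
        (by have := hz.1; rwa [mem_closedBall_iff_norm] at this)) s hs
  -- Disjointness of the projections is proved on the halved circles, which meet neither each other
  -- nor the box.
  have hdisk' : ∀ k > N, diskProj (formSum A μ v) μ k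
      = (c' k).rieszProj (pencilResolvent B (((1 : ℝ) : ℂ) • K)) := fun k hk => by
    rw [hdisk k hk, Contour.rieszProj, Contour.rieszProj, hmovek k hk 1 h1mem]
  have hidem0 : ∀ s ∈ Set.Icc (0 : ℝ) 1,
      IsIdempotentElem (c0.rieszProj (pencilResolvent B ((s : ℂ) • K))) := fun s hs => by
    refine Contour.isIdempotentElem_rieszProj (d := c0') (Set.disjoint_left.2 fun z e1 e2 => ?_)
      (hcontR _ adc0 s hs) (hcontR _ adc0' s hs)
      (fun z hz w hw => hident z w (adc0 z hz) (adc0' w hw) s hs)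
      (fun w hw => ?_) (fun z hz => ?_) (hmove0 s hs)
    · have := tr0 z e1
      have := tr0' z e2
      have := hr N
      grind
    · have := tr0' w hw
      have := hr N
      exact Contour.rect_index_of_mem hab hcd (by grind)
    · have := tr0 z hz
      have := hr N
      exact Contour.rect_index_of_notMem hab' hcd' (by grind)
  have hidemk : ∀ k > N, ∀ s ∈ Set.Icc (0 : ℝ) 1,
      IsIdempotentElem ((c k).rieszProj (pencilResolvent B ((s : ℂ) • K))) := fun k hk s hs => by
    refine Contour.isIdempotentElem_rieszProj (d := c' k) (Set.disjoint_left.2 fun z e1 e2 => ?_)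
      (hcontR _ (adck k hk) s hs) (hcontR _ (adck' k hk) s hs)
      (fun z hz w hw => hident z w (adck k hk z hz) (adck' k hk w hw) s hs)
      (fun w hw => ?_) (fun z hz => ?_) (hmovek k hk s hs)
    · linarith [trk k z e1, trk' k z e2, hr k]
    · refine Contour.circle_index_of_mem_ball (mem_ball_iff_norm.2 ?_)
      linarith [trk' k w hw, hr k]
    · refine Contour.circle_index_of_notMem_closedBall (half_pos (hr k)).le fun e => ?_
      rw [mem_closedBall_iff_norm] at e
      linarith [trk k z hz, hr k]
  have hre' : ∀ k > N, ∀ z ∈ (c' k).trace, b < z.re := fun k hk z hz => by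
    have e1 := abs_re_sub_le z (μ k)
    linarith [neg_le_abs (z.re - μ k), hgap k hk, trk' k z hz]
  have hout0 : ∀ k > N, ∀ w ∈ (c' k).trace, c0.index w = 0 := fun k hk w hw =>
    Contour.rect_index_of_notMem hab hcd fun e => by linarith [e.1.2, hre' k hk w hw]
  have houtk : ∀ k > N, ∀ z ∈ c0.trace, (c' k).index z = 0 := fun k hk z hz => by
    refine Contour.circle_index_of_notMem_closedBall (half_pos (hr k)).le fun e => ?_
    rw [mem_closedBall_iff_norm] at e
    have e1 := abs_re_sub_le z (μ k)
    linarith [neg_le_abs (z.re - μ k), hgap k hk, (tr0 z hz).1]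
  have hdisj0 : ∀ k > N, Disjoint c0.trace (c' k).trace := fun k hk =>
    Set.disjoint_left.2 fun z e1 e2 => by linarith [(tr0 z e1).1, hre' k hk z e2]
  have hfar : ∀ j k, j ≠ k → ∀ z ∈ (c' j).trace, radius μ k / 2 < ‖z - μ k‖ := by
    intro j k hjk z hz
    have e1 := two_mul_radius_le hmono hjk
    have e2 := two_mul_radius_le hmono hjk.symm
    rw [abs_sub_comm] at e2
    have e3 : |μ k - μ j| ≤ ‖z - μ j‖ + ‖z - μ k‖ := by
      have := norm_sub_le (z - μ j) (z - μ k)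
      rwa [sub_sub_sub_cancel_left, ← Complex.ofReal_sub, Complex.norm_real,
        Real.norm_eq_abs] at this
    linarith [trk' j z hz, hr j, hr k]
  have houtjk : ∀ j k, j ≠ k → ∀ z ∈ (c' j).trace, (c' k).index z = 0 := fun j k hjk z hz => by
    refine Contour.circle_index_of_notMem_closedBall (half_pos (hr k)).le fun e => ?_
    rw [mem_closedBall_iff_norm] at e
    linarith [hfar j k hjk z hz]
  -- ranks
  have hzero : ((0 : ℝ) : ℂ) • K = 0 := by rw [Complex.ofReal_zero, zero_smul]
  -- Admissibility does not involve `s`, so one contour serves the whole homotopy from `K` to `0`.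
  have hrank : ∀ e : Contour, (∀ z ∈ e.trace, IsAdmissible μ ω z) →
      (∀ s ∈ Set.Icc (0 : ℝ) 1, IsIdempotentElem (e.rieszProj (pencilResolvent B ((s : ℂ) • K)))) →
      ∀ S : Finset ℕ, (∀ j ∈ S, e.index (μ j) = 2 * Real.pi * Complex.I) →
      (∀ j ∉ S, e.index (μ j) = 0) →
      opRank (e.rieszProj (pencilResolvent B (((1 : ℝ) : ℂ) • K)))
        = opRank (∑ j ∈ S, specProj A μ j) := by
    intro e he hi S hS hS'
    have e1 := opRank_eq_of_continuousOn
      (continuousOn_rieszProj_pencilResolvent (B := B) (K := K) e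
        fun s hs z hz => hunit z (he z hz) s hs) hi
    rw [e1, hzero, Contour.rieszProj,
      hB.integral_pencilResolvent_zero e (fun z hz => (he z hz).1) hS hS']
    exact congrArg opRank (Finset.sum_congr rfl fun j _ => (hAB.specProj_eq hB j).symm)
  refine ⟨N, 2 * h, 2 * h, by linarith, by linarith, ?_, (hresC _ ?_).1, (hresC _ ?_).2,
    fun k hk => hresC _ ?_, ?_, fun k hk => ?_, fun k hk => ⟨?_, ?_⟩, fun j hj k hk hjk => ?_, ?_,
    fun k hk => ?_⟩
  · intro z hz
    by_contra hz'
    rw [Set.mem_union, not_or, Set.mem_iUnion₂] at hz'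
    obtain ⟨e1, e2⟩ := hz'
    push Not at e2
    refine hz ⟨_, hres z ?_⟩
    by_cases e3 : z.re ≤ b
    · by_cases e4 : z.re ≤ -h
      · exact ad1 z e4
      · refine ad2 z ?_ e3
        by_contra! e5
        exact e1 ⟨by linarith, e3, by linarith⟩
    · exact ad4 z (not_le.1 e3) e2
  iterate 2
    intro z hz
    obtain ⟨e1, e2, e3⟩ := frontier_box_subset hz
    refine adshell z e1 fun e => ?_
    have := abs_lt.2 e.2
    have := hr N
    grind
  · intro z hz
    rw [disk, frontier_ball _ (hr k).ne', mem_sphere_iff_norm] at hz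
    exact ad5 k hk z (by linarith [hr k]) hz.le
  · rw [hbox]
    exact hidem0 1 h1mem
  · rw [hdisk k hk]
    exact hidemk k hk 1 h1mem
  · rw [hbox, hdisk' k hk]
    exact Contour.rieszProj_mul_eq_zero (hdisj0 k hk) (hcontR _ adc0 1 h1mem)
      (hcontR _ (adck' k hk) 1 h1mem)
      (fun z hz w hw => hident z w (adc0 z hz) (adck' k hk w hw) 1 h1mem) (hout0 k hk) (houtk k hk)
  · rw [hbox, hdisk' k hk]
    exact Contour.rieszProj_mul_eq_zero (hdisj0 k hk).symm (hcontR _ (adck' k hk) 1 h1mem)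
      (hcontR _ adc0 1 h1mem)
      (fun z hz w hw => hident z w (adck' k hk z hz) (adc0 w hw) 1 h1mem) (houtk k hk) (hout0 k hk)
  · rw [hdisk' j hj, hdisk' k hk]
    refine Contour.rieszProj_mul_eq_zero (Set.disjoint_left.2 fun z e1 e2 => ?_)
      (hcontR _ (adck' j hj) 1 h1mem) (hcontR _ (adck' k hk) 1 h1mem)
      (fun z hz w hw => hident z w (adck' j hj z hz) (adck' k hk w hw) 1 h1mem)
      (houtjk k j hjk.symm) (houtjk j k hjk)
    exact (hfar j k hjk z e1).ne' (trk' k z e2)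
  · rw [hbox]
    refine hrank c0 adc0 hidem0 _ (fun j hj => ?_) fun j hj => ?_
    · have e1 : μ j ≤ μ N := hmono.monotone (Nat.lt_succ_iff.1 (Finset.mem_range.1 hj))
      have e2 := hB.mu_pos j
      refine Contour.rect_index_of_mem hab hcd ⟨⟨?_, ?_⟩, ?_, ?_⟩ <;> simp <;> linarith [hr N]
    · have e1 : N < j := by simpa [Nat.lt_succ_iff] using hj
      refine Contour.rect_index_of_notMem hab hcd fun e => ?_
      have e2 : μ j ≤ b := by simpa using e.1.2
      linarith [hgap j e1, hr j]
  · rw [hdisk k hk]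
    have := hrank (c k) (adck k hk) (hidemk k hk) {k} (fun j hj => ?_) fun j hj => ?_
    · rwa [Finset.sum_singleton] at this
    · rw [Finset.mem_singleton.1 hj]
      exact Contour.circle_index_of_mem_ball (Metric.mem_ball_self (hr k))
    · refine Contour.circle_index_of_notMem_closedBall (hr k).le fun e => ?_
      rw [Metric.mem_closedBall, Complex.dist_of_im_eq (by simp), Complex.ofReal_re,
        Complex.ofReal_re, Real.dist_eq, abs_sub_comm] at e
      have e1 := two_mul_radius_le hmono (show j ≠ k by simpa using hj)
      linarith [hr k]
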